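/- Let $(M,g)$ be a smooth finite-dimensional Lorentzian manifold (signature $-+\cdots+$), $V$ a smooth Killing field, $V^2=g_{ab}V^aV^b$, $H_{ab}=\nabla_a\nabla_b(-V^2/2)$, and let $\mathcal T=\{x:\nabla_a(V^2)=0\}$ be the locus where $V^2$ is extremized. **(1)** Through each point of $\mathcal T$ passes an integral curve of $V$, and every integral curve of $V$ (on an open interval) that meets $\mathcal T$ stays in $\mathcal T$ and is an affinely parametrized geodesic. **(2)** Let $\gamma:J\to\mathcal T$ be such a geodesic, $J$ a nonempty open interval. Let $\Phi(s,t)$ be a smooth one-parameter family of affinely parametrized geodesics $t\mapsto\Phi(s,t)$, defined on an open set containing $\{0\}\times J$, with $\Phi(0,t)=\gamma(t)$, and let $Y=\partial_s\Phi|_{s=0}$ be its deviation vector (a Jacobi field along $\gamma$). Let $\mathcal L_VY$ be the Lie derivative along $\gamma$, $\mathcal L_VY^a=dY^a/dt-Y^b\partial_bV^a$. Then there is a constant $C$ such that, along all of $\gamma$, $$(\mathcal L_VY_a)(\mathcal L_VY^a)+H_{ab}Y^aY^b=C.$$ **(3)** Suppose moreover that $\gamma$ is null ($V\neq0$ and $V^2=0$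 along $\gamma$) and that all geodesics of the family are causal (their tangent vectors are nonzero and timelike or null). Then $(\mathcal L_VY_a)(\mathcal L_VY^a)\ge0$ along $\gamma$, and: (a) If $-V^2/2$ has a local minimum at each point of $\gamma$ (for instance, if it is minimized on $\mathcal T$), then $C\ge0$, $H$ is positive semidefinite along $\gamma$, and $H_{ab}Y^aY^b\le C$. If in addition $\mathcal T$ is a timelike submanifold and, at the points of $\gamma$, $H$ is positive definite on the vectors normal to $\mathcal T$, then the component $Y^\perp$ of $Y$ normal to $\mathcal T$ stays bounded: $H_{ab}Y^{\perp a}Y^{\perp b}\le C$, and there is a constant $K$ with $0\le g_{ab}Y^{\perp a}Y^{\perp b}\le K$ along $\gamma$. (b) (Evanescent ergosurface, as in a 5d supersymmetric microstate geometry.) If $V^2=-f^2$ for a smooth function $f$ on $M$, $\mathcal S=\{f=0\}$ is a timelike hypersurface, and $V^2$ has a zero of exactly second order on $\mathcal S$ (that is, $H\ne0$ at each point of $\mathcal S$), then there is a constant $\alpha>0$ such that, at each point of $\gamma$, $H_{ab}=\alpha\,n_an_b$ with $n$ a unit normal of $\mathcal S$, and $$(n\cdot Y)^2\le C/\alpha,$$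 so the component of $Y$ normal to $\mathcal S$ stays bounded. -/

import Mathlib

open Set Filter Topology Bundle
open scoped Manifold ContDiff

noncomputable section

/-- A smooth Lorentzian metric, of signature `(-, +, ..., +)`, on a manifold `M` modelled on `E`. -/
structure LorentzMetric (E : Type*) [NormedAddCommGroup E] [NormedSpace ℝ E]
    (M : Type*) [TopologicalSpace M] [ChartedSpace E M] [IsManifold 𝓘(ℝ, E) ∞ M] where
  val : ∀ x : M, TangentSpace 𝓘(ℝ, E) x →L[ℝ] TangentSpace 𝓘(ℝ, E) x →L[ℝ] ℝ
  symm : ∀ (x : M) (u v : TangentSpace 𝓘(ℝ, E) x), val x u v = val x v u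
  lorentzian : ∀ x : M, ∃ v : TangentSpace 𝓘(ℝ, E) x, val x v v < 0 ∧
    ∀ w : TangentSpace 𝓘(ℝ, E) x, val x v w = 0 → w ≠ 0 → 0 < val x w w
  contMDiff : ContMDiff 𝓘(ℝ, E) (𝓘(ℝ, E).prod 𝓘(ℝ, E →L[ℝ] E →L[ℝ] ℝ)) ∞
    (fun x ↦ TotalSpace.mk' (E →L[ℝ] E →L[ℝ] ℝ) x (val x))

namespace LorentzMetric

variable {E : Type*} [NormedAddCommGroup E] [NormedSpace ℝ E]
  {M : Type*} [TopologicalSpace M] [ChartedSpace E M]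

/-- The coordinate expression, at the coordinate point `y`, of a vector field `V` in the chart
with index `x₀`. -/
def fieldInChart (V : ∀ x : M, TangentSpace 𝓘(ℝ, E) x) (x₀ : M) (y : E) : E :=
  mfderiv 𝓘(ℝ, E) 𝓘(ℝ, E) (extChartAt 𝓘(ℝ, E) x₀) ((extChartAt 𝓘(ℝ, E) x₀).symm y)
    (V ((extChartAt 𝓘(ℝ, E) x₀).symm y))

/-- The velocity of a curve. -/
def velocity (c : ℝ → M) (t : ℝ) : TangentSpace 𝓘(ℝ, E) (c t) :=
  mfderiv 𝓘(ℝ, ℝ) 𝓘(ℝ, E) c t (1 : ℝ)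

/-- The deviation vector `Y = ∂Φ/∂s` at `s = 0` of a one-parameter family of curves `t ↦ Φ (s, t)`,
a vector field along the curve `t ↦ Φ (0, t)`. -/
def deviation (Φ : ℝ × ℝ → M) (t : ℝ) : TangentSpace 𝓘(ℝ, E) (Φ (0, t)) :=
  mfderiv 𝓘(ℝ, ℝ) 𝓘(ℝ, E) (fun s : ℝ ↦ Φ (s, t)) 0 (1 : ℝ)

/-- The Lie derivative `ℒ_V Y` of a vector field `Y` along an integral curve `γ` of `V`. In
coordinates `(ℒ_V Y)^a = dY^a/dt - Y^b ∂_b V^a`; we use the chart at the point `γ t`, through which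
Mathlib identifies the tangent space at `γ t` with `E`. -/
def lieDerivAlong (V : ∀ x : M, TangentSpace 𝓘(ℝ, E) x) (γ : ℝ → M)
    (Y : ∀ t : ℝ, TangentSpace 𝓘(ℝ, E) (γ t)) (t : ℝ) : TangentSpace 𝓘(ℝ, E) (γ t) :=
  (deriv (fun τ : ℝ ↦
      (mfderiv 𝓘(ℝ, E) 𝓘(ℝ, E) (extChartAt 𝓘(ℝ, E) (γ t)) (γ τ) (Y τ) : E)) t
    - fderiv ℝ (fieldInChart V (γ t)) (extChartAt 𝓘(ℝ, E) (γ t) (γ t))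
        (mfderiv 𝓘(ℝ, E) 𝓘(ℝ, E) (extChartAt 𝓘(ℝ, E) (γ t)) (γ t) (Y t)) : E)

/-- The tangent space at `x` to a subset `S` of `M`: the span of the velocities at `x` of the
smooth curves that run in `S`. -/
def tangentTo (S : Set M) (x : M) : Submodule ℝ (TangentSpace 𝓘(ℝ, E) x) :=
  Submodule.span ℝ {v | ∃ c : ℝ → M, c 0 = x ∧ ContMDiffAt 𝓘(ℝ, ℝ) 𝓘(ℝ, E) ∞ c 0 ∧
    (∀ᶠ t in 𝓝 (0 : ℝ), c t ∈ S) ∧ (velocity (E := E) c 0 : E) = v}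

variable (E) in
/-- `S` is a (smooth, embedded) submanifold: near each of its points it is a linear slice in some
chart of the maximal smooth atlas. -/
def IsSubmanifold (S : Set M) : Prop :=
  ∀ x ∈ S, ∃ φ ∈ IsManifold.maximalAtlas 𝓘(ℝ, E) ∞ M, x ∈ φ.source ∧
    ∃ F : Submodule ℝ E, ∀ y ∈ φ.source, y ∈ S ↔ φ y - φ x ∈ F

variable [IsManifold 𝓘(ℝ, E) ∞ M] (g : LorentzMetric E M)

/-- The components `g_{ab}` of the metric at the coordinate point `y` in the chart with index
`x₀`. -/
def inChart (x₀ : M) (y : E) : E →L[ℝ] E →L[ℝ] ℝ :=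
  let G : E →L[ℝ] E →L[ℝ] ℝ := g.val ((extChartAt 𝓘(ℝ, E) x₀).symm y)
  let L : E →L[ℝ] E := mfderiv 𝓘(ℝ, E) 𝓘(ℝ, E) (extChartAt 𝓘(ℝ, E) x₀).symm y
  G.bilinearComp L L

/-- The Christoffel symbols
`Γ^a_{bc} u^b v^c = (1/2) g^{ad} (∂_b g_{cd} + ∂_c g_{bd} - ∂_d g_{bc}) u^b v^c` of the Levi-Civita
connection at the coordinate point `y` in the chart with index `x₀`. -/
def christoffel (x₀ : M) (y : E) (u v : E) : E :=
  ContinuousLinearMap.inverse (g.inChart x₀ y)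
    ((1 / 2 : ℝ) • (fderiv ℝ (g.inChart x₀) y u v + fderiv ℝ (g.inChart x₀) y v u
      - ((fderiv ℝ (g.inChart x₀) y).flip u).flip v))

/-- `c` is an affinely parametrized geodesic on the open set `J` of parameters:
`d²c^a/dt² + Γ^a_{bc} (dc^b/dt) (dc^c/dt) = 0` in each chart of the atlas. -/
def IsGeodesicOn (c : ℝ → M) (J : Set ℝ) : Prop :=
  ContMDiffOn 𝓘(ℝ, ℝ) 𝓘(ℝ, E) ∞ c J ∧
  ∀ t ∈ J, ∀ x₀ : M, c t ∈ (extChartAt 𝓘(ℝ, E) x₀).source →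
    deriv (deriv fun τ : ℝ ↦ extChartAt 𝓘(ℝ, E) x₀ (c τ)) t
      + g.christoffel x₀ (extChartAt 𝓘(ℝ, E) x₀ (c t))
          (deriv (fun τ : ℝ ↦ extChartAt 𝓘(ℝ, E) x₀ (c τ)) t)
          (deriv (fun τ : ℝ ↦ extChartAt 𝓘(ℝ, E) x₀ (c τ)) t) = 0

/-- The covariant Hessian `∇_a ∇_b F = ∂_a ∂_b F - Γ^c_{ab} ∂_c F` at `x` of a function `F`,
in the chart at `x`, through which Mathlib identifies the tangent space at `x` with `E`. -/
def hessian (F : M → ℝ) (x : M) (u v : TangentSpace 𝓘(ℝ, E) x) : ℝ :=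
  fderiv ℝ (fderiv ℝ (F ∘ (extChartAt 𝓘(ℝ, E) x).symm)) (extChartAt 𝓘(ℝ, E) x x) (u : E) (v : E)
    - fderiv ℝ (F ∘ (extChartAt 𝓘(ℝ, E) x).symm) (extChartAt 𝓘(ℝ, E) x x)
        (g.christoffel x (extChartAt 𝓘(ℝ, E) x x) u v)

/-- `V` is a smooth Killing vector field: `ℒ_V g = 0`, that is,
`V^c ∂_c g_{ab} + g_{cb} ∂_a V^c + g_{ac} ∂_b V^c = 0` in each chart of the atlas. -/
def IsKilling (V : ∀ x : M, TangentSpace 𝓘(ℝ, E) x) : Prop :=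
  ContMDiff 𝓘(ℝ, E) 𝓘(ℝ, E).tangent ∞ (fun x ↦ (⟨x, V x⟩ : TangentBundle 𝓘(ℝ, E) M)) ∧
  ∀ x₀ : M, ∀ y ∈ (extChartAt 𝓘(ℝ, E) x₀).target, ∀ u w : E,
    fderiv ℝ (g.inChart x₀) y (fieldInChart V x₀ y) u w
      + g.inChart x₀ y (fderiv ℝ (fieldInChart V x₀) y u) w
      + g.inChart x₀ y u (fderiv ℝ (fieldInChart V x₀) y w) = 0

/-- The function `V² = g_{ab} V^a V^b`. -/
def normSq (V : ∀ x : M, TangentSpace 𝓘(ℝ, E) x) (x : M) : ℝ := g.val x (V x) (V x)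

/-- The locus `𝒯` where `V²` is extremized, `∇_a (V²) = 0`. -/
def extremalLocus (V : ∀ x : M, TangentSpace 𝓘(ℝ, E) x) : Set M :=
  {x | mfderiv 𝓘(ℝ, E) 𝓘(ℝ, ℝ) (g.normSq V) x = 0}

/-- The potential `-V²/2`. -/
def potential (V : ∀ x : M, TangentSpace 𝓘(ℝ, E) x) (x : M) : ℝ := -(g.normSq V x) / 2

/-- A null vector. -/
def IsNull {x : M} (v : TangentSpace 𝓘(ℝ, E) x) : Prop := v ≠ 0 ∧ g.val x v v = 0

/-- A causal (timelike or null) vector. -/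
def IsCausal {x : M} (v : TangentSpace 𝓘(ℝ, E) x) : Prop := v ≠ 0 ∧ g.val x v v ≤ 0

/-- `Φ : U → M` is a smooth one-parameter family of affinely parametrized geodesics
`t ↦ Φ (s, t)`, whose member `t ↦ Φ (0, t)` is defined at least on `J`. The range of the
parameter `s` about `0` may depend on `t`. -/
structure IsGeodesicFamily (Φ : ℝ × ℝ → M) (U : Set (ℝ × ℝ)) (J : Set ℝ) : Prop where
  isOpen : IsOpen U
  mem : ∀ t ∈ J, ((0 : ℝ), t) ∈ U
  contMDiffOn : ContMDiffOn 𝓘(ℝ, ℝ × ℝ) 𝓘(ℝ, E) ∞ Φ U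
  geodesic : ∀ s : ℝ, g.IsGeodesicOn (fun t ↦ Φ (s, t)) {t | (s, t) ∈ U}

/-- `n` is normal at `x` to the subset `S`. -/
def IsNormalTo (S : Set M) (x : M) (n : TangentSpace 𝓘(ℝ, E) x) : Prop :=
  ∀ v ∈ tangentTo (E := E) S x, g.val x n v = 0

/-- `S` is a timelike submanifold: the metric that `g` induces on it is Lorentzian, that is, each of
its tangent spaces contains a timelike vector. -/
def IsTimelikeSubmanifold (S : Set M) : Prop :=
  IsSubmanifold E S ∧ ∀ x ∈ S, ∃ v ∈ tangentTo (E := E) S x, g.val x v v < 0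

/-- `S` is a timelike hypersurface: a timelike submanifold of codimension one. -/
def IsTimelikeHypersurface (S : Set M) : Prop :=
  g.IsTimelikeSubmanifold S ∧
    ∀ x ∈ S, Module.finrank ℝ (tangentTo (E := E) S x) + 1 = Module.finrank ℝ E

end LorentzMetric

end

/-! The first integral is the second variation of a conserved quantity. Along a geodesic c both
g(c', c') and the Killing charge g(c', V) are constant, hence so is g(c', c') - 2 g(c', V) = g(c' -
V, c' - V) - V². Apply this to the geodesics Φ(s, ·) and expand in s at fixed t. At s = 0 the
velocity is V, so the first square starts at order s²; since mixed partial derivatives commute, ∂_s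
(c' - V) = ∂_t Y - Y^b ∂_b V = ℒ_V Y there. As V² is critical on γ, its second-order term is a
tensor in Y alone, and -V² contributes s² H(Y, Y). Half the second s-derivative is thus g(ℒ_V Y, ℒ_V
Y) + H(Y, Y), and it does not depend on t because the energy does not. Neither curvature nor the
Jacobi equation is needed (`KillingData.deriv_deriv_sub_sq`, `deriv_deriv_energy`,
`exists_first_integral`).

The linearized flow of V preserves g and d(V²), and also the second derivative of V² where d(V²) = 0
(`exists_transport_equiv`). Hence integral curves cannot leave the locus, and the Killing equation
makes them geodesics there: ∇_V V = -(1/2) grad V².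

For a causal family around a null γ, g(c', c') is maximal at s = 0. Its vanishing first variation
says that ℒ_V Y is orthogonal to V, and a vector orthogonal to a null vector is not timelike; so
H(Y, Y) ≤ C. Constants valid along all of γ come from the flow again: a relation between g and H
that is invariant under linear isomorphisms holds along γ once it holds at one point
(`of_invariant`). On an evanescent ergosurface H = df ⊗ df, and the gradient of f gives the normal.
-/

set_option maxSynthPendingDepth 3
set_option linter.unusedSectionVars false

/-! ### Linear algebra of Lorentzian forms. -/

section LorentzForm

variable {E : Type*} [NormedAddCommGroup E] [NormedSpace ℝ E]

/-- A symmetric bilinear form of signature `(-, +, ..., +)`. -/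
structure IsLorentzForm (B : E →L[ℝ] E →L[ℝ] ℝ) : Prop where
  symm : ∀ u v, B u v = B v u
  exists_timelike : ∃ v, B v v < 0 ∧ ∀ w, B v w = 0 → w ≠ 0 → 0 < B w w

namespace IsLorentzForm

variable {B : E →L[ℝ] E →L[ℝ] ℝ}

/-- The Cauchy-Schwarz inequality on the orthogonal complement of a timelike vector. -/
theorem cauchy_schwarz (hB : IsLorentzForm B) {T : E}
    (hT : ∀ w, B T w = 0 → w ≠ 0 → 0 < B w w) {u w : E} (hu : B T u = 0) (hw : B T w = 0) :
    B u w ^ 2 ≤ B u u * B w w := by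
  have hpos : ∀ z, B T z = 0 → 0 ≤ B z z := fun z hz ↦ by
    rcases eq_or_ne z 0 with rfl | h
    · simp
    · exact (hT z hz h).le
  -- The quadratic x ↦ B(u + xw, u + xw) is nonnegative, so its discriminant is at most zero.
  have h := discrim_le_zero (a := B w w) (b := 2 * B u w) (c := B u u) fun x ↦ by
    have := hpos (u + x • w) (by simp [hu, hw])
    simp only [map_add, map_smul, add_apply,
      smul_apply, smul_eq_mul, hB.symm w u] at this
    linarith
  rw [discrim] at h
  linarith

/-- The orthogonal decomposition of a vector along a timelike vector. -/
theorem exists_decomposition {T : E} (hT : B T T < 0) (v : E) :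
    ∃ (a : ℝ) (v' : E), v = a • T + v' ∧ B T v' = 0 := by
  refine ⟨B T v / B T T, v - (B T v / B T T) • T, by abel, ?_⟩
  simp [div_mul_cancel₀ _ hT.ne]

/-- Split both vectors along a timelike T. Causality of v bounds its spatial part by its time part,
orthogonality expresses the product of the spatial parts through the time parts, and Cauchy-Schwarz
on the complement of T then makes the spatial part of p dominate its time part. This yields the
signs of ℒ_V Y and of normal vectors. -/
theorem nonneg_of_orthogonal (hB : IsLorentzForm B) {v p : E} (hv : B v v ≤ 0) (hv0 : v ≠ 0)
    (hvp : B v p = 0) : 0 ≤ B p p := by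
  obtain ⟨T, hT, hT'⟩ := hB.exists_timelike
  obtain ⟨a, v', rfl, hv'⟩ := exists_decomposition hT v
  obtain ⟨b, p', rfl, hp'⟩ := exists_decomposition hT p
  have hv'T := (hB.symm v' T).trans hv'
  have hp'T := (hB.symm p' T).trans hp'
  simp only [map_add, map_smul, add_apply, smul_apply,
    smul_eq_mul, hv', hp', hv'T, hp'T] at hv hvp ⊢
  have hcs := hB.cauchy_schwarz hT' hv' hp'
  -- Without a component along T the nonzero vector v would be spacelike.
  have ha : a ≠ 0 := by
    rintro rfl
    have h0 : v' ≠ 0 := by simpa using hv0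
    have := hT' v' hv' h0
    linarith
  have hpp : 0 ≤ B p' p' := by
    rcases eq_or_ne p' 0 with rfl | h
    · simp
    · exact (hT' p' hp' h).le
  have ha2 : 0 < a ^ 2 * (-B T T) := mul_pos (by positivity) (by linarith)
  have h1 : B v' p' = a * b * (-B T T) := by linarith
  have h2 : B v' v' * B p' p' ≤ (a ^ 2 * (-B T T)) * B p' p' :=
    mul_le_mul_of_nonneg_right (by linarith) hpp
  rw [h1] at hcs
  have h3 : (a ^ 2 * (-B T T)) * (b ^ 2 * (-B T T)) ≤ (a ^ 2 * (-B T T)) * B p' p' := by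
    calc _ = (a * b * (-B T T)) ^ 2 := by ring
      _ ≤ _ := hcs.trans h2
  have := le_of_mul_le_mul_left h3 ha2
  linarith

theorem pos_of_orthogonal (hB : IsLorentzForm B) {v p : E} (hv : B v v < 0)
    (hvp : B v p = 0) (hp0 : p ≠ 0) : 0 < B p p := by
  have hv0 : v ≠ 0 := by rintro rfl; simp at hv
  refine lt_of_le_of_ne (hB.nonneg_of_orthogonal hv.le hv0 hvp) fun h ↦ ?_
  -- If p were null, the same lemma with the roles exchanged would make v non-timelike.
  have := hB.nonneg_of_orthogonal h.symm.le hp0 ((hB.symm p v).trans hvp)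
  linarith

theorem eq_zero_of_forall (hB : IsLorentzForm B) {u : E} (hu : ∀ w, B u w = 0) : u = 0 := by
  obtain ⟨T, hT, hT'⟩ := hB.exists_timelike
  by_contra h
  have := hT' u ((hB.symm T u).trans (hu T)) h
  rw [hu u] at this
  exact lt_irrefl _ this

/-- Nondegeneracy and equality of dimensions make B an isomorphism onto the dual, so
`ContinuousLinearMap.inverse` is a true inverse and not its default value 0. This is what gives the
Christoffel symbols and gradients their meaning. -/
theorem apply_inverse [FiniteDimensional ℝ E] (hB : IsLorentzForm B) (f : E →L[ℝ] ℝ) :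
    B (ContinuousLinearMap.inverse B f) = f := by
  have hinj : Function.Injective (B : E →ₗ[ℝ] (E →L[ℝ] ℝ)) := by
    rw [← LinearMap.ker_eq_bot, LinearMap.ker_eq_bot']
    exact fun u hu ↦ hB.eq_zero_of_forall fun w ↦ by
      have : B u = 0 := hu
      simp [this]
  have hdim : Module.finrank ℝ E = Module.finrank ℝ (E →L[ℝ] ℝ) := by
    rw [← (LinearMap.toContinuousLinearMap (𝕜 := ℝ) (E := E) (F' := ℝ)).finrank_eq]
    exact Subspace.dual_finrank_eq.symm
  let e : E ≃L[ℝ] (E →L[ℝ] ℝ) :=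
    (LinearEquiv.ofInjectiveOfFinrankEq (B : E →ₗ[ℝ] (E →L[ℝ] ℝ)) hinj
      hdim).toContinuousLinearEquiv
  have he : B = (e : E →L[ℝ] (E →L[ℝ] ℝ)) := by ext; rfl
  rw [he, ContinuousLinearMap.inverse_equiv]
  simp

/-- A subspace containing a timelike vector T is nondegenerate: a vector of W orthogonal to W is
orthogonal to T, hence zero or spacelike, while its square is 0. So every functional on W is
represented by an element of W. -/
theorem exists_orthogonal_projection [FiniteDimensional ℝ E] (hB : IsLorentzForm B)
    {W : Submodule ℝ E} (hW : ∃ T ∈ W, B T T < 0) (y : E) :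
    ∃ w, (∀ z ∈ W, B w z = 0) ∧ y - w ∈ W := by
  obtain ⟨T, hTW, hT⟩ := hW
  let L : E →ₗ[ℝ] Module.Dual ℝ W :=
    { toFun := fun u ↦ (B u : E →ₗ[ℝ] ℝ) ∘ₗ W.subtype
      map_add' := fun a b ↦ by ext; simp
      map_smul' := fun a b ↦ by ext; simp }
  have hinj : Function.Injective (L ∘ₗ W.subtype) := by
    rw [← LinearMap.ker_eq_bot, LinearMap.ker_eq_bot']
    rintro ⟨u, hu⟩ h
    have h' : ∀ z ∈ W, B u z = 0 := fun z hz ↦ LinearMap.congr_fun h ⟨z, hz⟩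
    ext
    by_contra hne
    have := hB.pos_of_orthogonal hT ((hB.symm T u).trans (h' T hTW)) hne
    rw [h' u hu] at this
    exact lt_irrefl _ this
  have hsurj := (LinearMap.injective_iff_surjective_of_finrank_eq_finrank
    (Subspace.dual_finrank_eq (K := ℝ) (V := W)).symm).1 hinj
  obtain ⟨⟨u, hu⟩, hy⟩ := hsurj (L y)
  refine ⟨y - u, fun z hz ↦ ?_, by simpa using hu⟩
  have := LinearMap.congr_fun hy ⟨z, hz⟩
  change B u z = B y z at this
  simp [this]

end IsLorentzForm

end LorentzForm

/-! ### Killing fields in coordinates: invariance of V² and conservation of the energy. -/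

section KillingCoordinates

variable {E : Type*} [NormedAddCommGroup E] [NormedSpace ℝ E]

/-- The coordinate expression of a metric with a Killing field, on an open subset of a vector
space. -/
structure KillingData (Ω : Set E) (G : E → E →L[ℝ] E →L[ℝ] ℝ) (v : E → E) : Prop where
  isOpen : IsOpen Ω
  contDiffOn_metric : ContDiffOn ℝ ∞ G Ω
  contDiffOn_field : ContDiffOn ℝ ∞ v Ω
  symm : ∀ y ∈ Ω, ∀ u w, G y u w = G y w u
  killing : ∀ y ∈ Ω, ∀ u w,
    fderiv ℝ G y (v y) u w + G y (fderiv ℝ v y u) w + G y u (fderiv ℝ v y w) = 0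

theorem two_le_infty : (2 : WithTop ℕ∞) ≤ ∞ := by
  have h : ((2 : ℕ∞) : WithTop ℕ∞) ≤ ((⊤ : ℕ∞) : WithTop ℕ∞) := WithTop.coe_le_coe.2 le_top
  exact h

theorem HasDerivAt.bilinear_apply {B : ℝ → E →L[ℝ] E →L[ℝ] ℝ} {B' : E →L[ℝ] E →L[ℝ] ℝ}
    {a b : ℝ → E} {a' b' : E} {t : ℝ} (hB : HasDerivAt B B' t) (ha : HasDerivAt a a' t)
    (hb : HasDerivAt b b' t) :
    HasDerivAt (fun τ ↦ B τ (a τ) (b τ)) (B' (a t) (b t) + B t a' (b t) + B t (a t) b') t :=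
  (hB.clm_apply ha).clm_apply hb

theorem ContDiffAt.differentiableAt_deriv {F : Type*} [NormedAddCommGroup F] [NormedSpace ℝ F]
    {a : ℝ → F} {s : ℝ} (ha : ContDiffAt ℝ 2 a s) : DifferentiableAt ℝ (deriv a) s :=
  (((ha.fderiv_right (m := 1) (by norm_num)).clm_apply
    (contDiffAt_const (c := (1 : ℝ)))).differentiableAt (by simp) :)

namespace KillingData

variable {Ω : Set E} {G : E → E →L[ℝ] E →L[ℝ] ℝ} {v : E → E} {y : E}

theorem contDiffAt_metric (h : KillingData Ω G v) (hy : y ∈ Ω) : ContDiffAt ℝ ∞ G y :=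
  h.contDiffOn_metric.contDiffAt (h.isOpen.mem_nhds hy)

theorem contDiffAt_field (h : KillingData Ω G v) (hy : y ∈ Ω) : ContDiffAt ℝ ∞ v y :=
  h.contDiffOn_field.contDiffAt (h.isOpen.mem_nhds hy)

theorem hasFDerivAt_metric (h : KillingData Ω G v) (hy : y ∈ Ω) :
    HasFDerivAt G (fderiv ℝ G y) y :=
  ((h.contDiffAt_metric hy).differentiableAt (by simp)).hasFDerivAt

theorem hasFDerivAt_field (h : KillingData Ω G v) (hy : y ∈ Ω) :
    HasFDerivAt v (fderiv ℝ v y) y :=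
  ((h.contDiffAt_field hy).differentiableAt (by simp)).hasFDerivAt

/-- The derivative of the metric applied to two vector fields along a curve. -/
theorem hasDerivAt_metric_apply (h : KillingData Ω G v) {c a b : ℝ → E} {c' a' b' : E} {t : ℝ}
    (hy : c t ∈ Ω) (hc : HasDerivAt c c' t) (ha : HasDerivAt a a' t) (hb : HasDerivAt b b' t) :
    HasDerivAt (fun τ ↦ G (c τ) (a τ) (b τ))
      (fderiv ℝ G (c t) c' (a t) (b t) + G (c t) a' (b t) + G (c t) (a t) b') t := by
  have hB : HasDerivAt (fun τ ↦ G (c τ)) (fderiv ℝ G (c t) c') t :=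
    (h.hasFDerivAt_metric hy).comp_hasDerivAt t hc
  exact hB.bilinear_apply ha hb

theorem hasDerivAt_field_comp (h : KillingData Ω G v) {c : ℝ → E} {c' : E} {t : ℝ}
    (hy : c t ∈ Ω) (hc : HasDerivAt c c' t) :
    HasDerivAt (fun τ ↦ v (c τ)) (fderiv ℝ v (c t) c') t :=
  (h.hasFDerivAt_field hy).comp_hasDerivAt t hc

/-- The square `G(v, v)` of the Killing field. -/
theorem contDiffOn_sq (h : KillingData Ω G v) : ContDiffOn ℝ ∞ (fun y ↦ G y (v y) (v y)) Ω :=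
  (h.contDiffOn_metric.clm_apply h.contDiffOn_field).clm_apply h.contDiffOn_field

theorem contDiffAt_sq (h : KillingData Ω G v) (hy : y ∈ Ω) :
    ContDiffAt ℝ ∞ (fun y ↦ G y (v y) (v y)) y :=
  h.contDiffOn_sq.contDiffAt (h.isOpen.mem_nhds hy)

theorem fderiv_sq (h : KillingData Ω G v) (hy : y ∈ Ω) (w : E) :
    fderiv ℝ (fun y ↦ G y (v y) (v y)) y w
      = fderiv ℝ G y w (v y) (v y) + 2 * G y (fderiv ℝ v y w) (v y) := by
  have := ((h.hasFDerivAt_metric hy).clm_apply (h.hasFDerivAt_field hy)).clm_apply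
    (h.hasFDerivAt_field hy)
  rw [this.fderiv]
  simp [h.symm y hy (v y) (fderiv ℝ v y w)]
  ring

theorem fderiv_sq_self (h : KillingData Ω G v) (hy : y ∈ Ω) :
    fderiv ℝ (fun y ↦ G y (v y) (v y)) y (v y) = 0 := by
  rw [h.fderiv_sq hy, ← h.killing y hy (v y) (v y), h.symm y hy (v y)]
  ring

theorem hasFDerivAt_fderiv_sq (h : KillingData Ω G v) (hy : y ∈ Ω) :
    HasFDerivAt (fderiv ℝ (fun y ↦ G y (v y) (v y)))
      (fderiv ℝ (fderiv ℝ (fun y ↦ G y (v y) (v y))) y) y :=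
  (((h.contDiffAt_sq hy).fderiv_right (m := ∞) (by simp)).differentiableAt (by simp)).hasFDerivAt

theorem fderiv_fderiv_sq_symm (h : KillingData Ω G v) (hy : y ∈ Ω) (u w : E) :
    fderiv ℝ (fderiv ℝ (fun y ↦ G y (v y) (v y))) y u w
      = fderiv ℝ (fderiv ℝ (fun y ↦ G y (v y) (v y))) y w u :=
  ((h.contDiffAt_sq hy).isSymmSndFDerivAt (by simpa using two_le_infty)) u w

/-- The differential of the square of a Killing field is invariant under its flow. -/
theorem fderiv_fderiv_sq_apply_field (h : KillingData Ω G v) (hy : y ∈ Ω) :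
    fderiv ℝ (fderiv ℝ (fun y ↦ G y (v y) (v y))) y (v y)
      = -((fderiv ℝ (fun y ↦ G y (v y) (v y)) y).comp (fderiv ℝ v y)) := by
  have h1 := (h.hasFDerivAt_fderiv_sq hy).clm_apply (h.hasFDerivAt_field hy)
  -- The identity d(V²)(V) = 0 holds on an open set, so it can be differentiated; symmetry of second
  -- derivatives does the rest.
  have h2 : HasFDerivAt (fun x ↦ fderiv ℝ (fun y ↦ G y (v y) (v y)) x (v x))
      (0 : E →L[ℝ] ℝ) y :=
    (hasFDerivAt_const (0 : ℝ) y).congr_of_eventuallyEq (by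
      filter_upwards [h.isOpen.mem_nhds hy] with x hx using h.fderiv_sq_self hx)
  ext w
  have := DFunLike.congr_fun (h1.unique h2) w
  simp only [add_apply, ContinuousLinearMap.comp_apply, ContinuousLinearMap.flip_apply,
    zero_apply] at this
  simp only [neg_apply, ContinuousLinearMap.comp_apply]
  rw [h.fderiv_fderiv_sq_symm hy]
  linarith

/-- The second derivative of the square of a Killing field is invariant under its flow at the
points where the first derivative vanishes. -/
theorem fderiv_fderiv_fderiv_sq_apply_field (h : KillingData Ω G v) (hy : y ∈ Ω)
    (h0 : fderiv ℝ (fun y ↦ G y (v y) (v y)) y = 0) (u w : E) :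
    fderiv ℝ (fderiv ℝ (fderiv ℝ (fun y ↦ G y (v y) (v y)))) y (v y) u w
      + fderiv ℝ (fderiv ℝ (fun y ↦ G y (v y) (v y))) y (fderiv ℝ v y u) w
      + fderiv ℝ (fderiv ℝ (fun y ↦ G y (v y) (v y))) y u (fderiv ℝ v y w) = 0 := by
  set N : E → ℝ := fun y ↦ G y (v y) (v y) with hN
  have hc1 : ContDiffAt ℝ ∞ (fderiv ℝ N) y := (h.contDiffAt_sq hy).fderiv_right (by simp)
  have hc2 : ContDiffAt ℝ ∞ (fderiv ℝ (fderiv ℝ N)) y := hc1.fderiv_right (by simp)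
  have hv1 : ContDiffAt ℝ ∞ (fderiv ℝ v) y := (h.contDiffAt_field hy).fderiv_right (by simp)
  have d2 := (hc2.differentiableAt (by simp)).hasFDerivAt
  have dv := (hv1.differentiableAt (by simp)).hasFDerivAt
  have h1 := d2.clm_apply (h.hasFDerivAt_field hy)
  -- The invariance of d(V²) is differentiated once more. The only non-tensorial term, d(V²) applied
  -- to the second derivative of v, vanishes by `h0`.
  have h2 := ((h.hasFDerivAt_fderiv_sq hy).clm_comp dv).neg
  have h3 := h2.congr_of_eventuallyEq (f₁ := fun x ↦ fderiv ℝ (fderiv ℝ N) x (v x)) (by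
      filter_upwards [h.isOpen.mem_nhds hy] with x hx using h.fderiv_fderiv_sq_apply_field hx)
  have h4 := DFunLike.congr_fun (DFunLike.congr_fun (h1.unique h3) u) w
  have hs : fderiv ℝ (fderiv ℝ (fderiv ℝ N)) y u (v y)
      = fderiv ℝ (fderiv ℝ (fderiv ℝ N)) y (v y) u :=
        (hc1.isSymmSndFDerivAt (by simpa using two_le_infty)) u (v y)
  rw [← hN, h0] at h4
  simp [hs] at h4
  linarith

/-- A Killing field is geodesic where its square is critical. -/
theorem metric_fderiv_field_self (h : KillingData Ω G v) (hy : y ∈ Ω)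
    (h0 : fderiv ℝ (fun y ↦ G y (v y) (v y)) y = 0) (w : E) :
    G y (fderiv ℝ v y (v y)) w
      = -fderiv ℝ G y (v y) (v y) w + (1 / 2) * fderiv ℝ G y w (v y) (v y) := by
  have h1 := h.fderiv_sq hy w
  have h2 := h.killing y hy (v y) w
  rw [h0] at h1
  rw [h.symm y hy (v y)] at h2
  simp only [zero_apply] at h1
  linarith

/-- The energy of a geodesic, minus twice its Killing charge, is conserved. -/
theorem hasDerivAt_energy (h : KillingData Ω G v) {c c₁ : ℝ → E} {c₂ : E} {t : ℝ}
    (hy : c t ∈ Ω) (hc : HasDerivAt c (c₁ t) t) (hc₁ : HasDerivAt c₁ c₂ t)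
    (hgeo : ∀ w, G (c t) c₂ w
      = -fderiv ℝ G (c t) (c₁ t) (c₁ t) w + (1 / 2) * fderiv ℝ G (c t) w (c₁ t) (c₁ t)) :
    HasDerivAt (fun τ ↦ G (c τ) (c₁ τ) (c₁ τ) - 2 * G (c τ) (c₁ τ) (v (c τ))) 0 t := by
  have h1 := h.hasDerivAt_metric_apply hy hc hc₁ hc₁
  have h2 := h.hasDerivAt_metric_apply hy hc hc₁ (h.hasDerivAt_field_comp hy hc)
  convert! h1.sub (h2.const_mul 2) using 1
  -- The geodesic equation alone cancels the energy term; in the charge term it leaves half of the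
  -- Killing equation evaluated on the velocity.
  have hk := h.killing (c t) hy (c₁ t) (c₁ t)
  rw [h.symm _ hy (c₁ t) c₂, hgeo, hgeo]
  rw [h.symm _ hy _ (c₁ t)] at hk
  linarith

/-- The second derivative of `G(w, w) - G(v, v)` along a curve, at a critical point of `G(v, v)`
where `w` vanishes. -/
theorem deriv_deriv_sub_sq (h : KillingData Ω G v) {a w : ℝ → E} {s : ℝ} (hy : a s ∈ Ω)
    (ha : ContDiffAt ℝ 2 a s) (hw : ContDiffAt ℝ 2 w s) (hw0 : w s = 0)
    (h0 : fderiv ℝ (fun y ↦ G y (v y) (v y)) (a s) = 0) :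
    deriv (deriv fun σ ↦ G (a σ) (w σ) (w σ) - G (a σ) (v (a σ)) (v (a σ))) s
      = 2 * G (a s) (deriv w s) (deriv w s)
        - fderiv ℝ (fderiv ℝ (fun y ↦ G y (v y) (v y))) (a s) (deriv a s) (deriv a s) := by
  set N : E → ℝ := fun y ↦ G y (v y) (v y) with hN
  have hGa : ContDiffAt ℝ 2 (fun σ ↦ G (a σ)) s :=
    ((h.contDiffAt_metric hy).of_le two_le_infty).comp s ha
  have hev : deriv (fun σ ↦ G (a σ) (w σ) (w σ) - N (a σ)) =ᶠ[𝓝 s]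
      fun σ ↦ deriv (fun σ ↦ G (a σ)) σ (w σ) (w σ) + 2 * G (a σ) (deriv w σ) (w σ)
        - fderiv ℝ N (a σ) (deriv a σ) := by
    filter_upwards [ha.eventually (by simp), hw.eventually (by simp), hGa.eventually (by simp),
      ha.continuousAt.eventually (h.isOpen.mem_nhds hy)] with σ h1 h2 h4 h3
    have d1 := (h1.differentiableAt (by simp)).hasDerivAt
    have d2 := (h2.differentiableAt (by simp)).hasDerivAt
    have d4 := (h4.differentiableAt (by simp)).hasDerivAt
    have d3 := ((h.contDiffAt_sq h3).differentiableAt (by simp)).hasFDerivAt.comp_hasDerivAt σ d1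
    refine ((d4.bilinear_apply d2 d2).sub d3).deriv.trans ?_
    rw [h.symm _ h3 (w σ)]
    ring
  rw [hev.deriv_eq]
  have hda := (ha.differentiableAt (by simp)).hasDerivAt
  have hdw := (hw.differentiableAt (by simp)).hasDerivAt
  have hdGa := (hGa.differentiableAt (by simp)).hasDerivAt
  -- As w vanishes at s, the term `k1` is zero and `k2` keeps only the factor in which both copies
  -- of w are differentiated. In `k3` the acceleration of a is killed by criticality.
  have k1 := hGa.differentiableAt_deriv.hasDerivAt.bilinear_apply hdw hdw
  have k2 := (hdGa.bilinear_apply hw.differentiableAt_deriv.hasDerivAt hdw).const_mul 2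
  have k3 := ((h.hasFDerivAt_fderiv_sq hy).comp_hasDerivAt s hda).clm_apply
    ha.differentiableAt_deriv.hasDerivAt
  refine ((k1.add k2).sub k3).deriv.trans ?_
  simp only [hw0, map_zero, zero_apply, add_zero, zero_add, Function.comp_apply, ← hN, h0]

end KillingData

end KillingCoordinates

/-! ### Passage between the manifold and its charts. -/

namespace LorentzMetric

section Charts

variable {E : Type*} [NormedAddCommGroup E] [NormedSpace ℝ E]
  {M : Type*} [TopologicalSpace M] [ChartedSpace E M] [IsManifold 𝓘(ℝ, E) ∞ M]
  {x₀ x : M} {y : E}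

/-- The derivative at `x` of the chart with index `x₀`, as an endomorphism of the model space. -/
noncomputable def chartDeriv (x₀ x : M) : E →L[ℝ] E :=
  mfderiv 𝓘(ℝ, E) 𝓘(ℝ, E) (extChartAt 𝓘(ℝ, E) x₀) x

/-- The derivative at `y` of the inverse of the chart with index `x₀`, as an endomorphism of the
model space. -/
noncomputable def chartSymmDeriv (x₀ : M) (y : E) : E →L[ℝ] E :=
  mfderiv 𝓘(ℝ, E) 𝓘(ℝ, E) (extChartAt 𝓘(ℝ, E) x₀).symm y

theorem chartSymmDeriv_chartDeriv (hx : x ∈ (extChartAt 𝓘(ℝ, E) x₀).source) (u : E) :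
    chartSymmDeriv x₀ (extChartAt 𝓘(ℝ, E) x₀ x) (chartDeriv x₀ x u) = u := by
  have : IsManifold 𝓘(ℝ, E) 1 M := IsManifold.of_le (n := ∞) (by simp)
  have := mfderivWithin_extChartAt_symm_comp_mfderiv_extChartAt' (I := 𝓘(ℝ, E)) hx
  rw [ModelWithCorners.range_eq_univ, mfderivWithin_univ] at this
  exact DFunLike.congr_fun this u

theorem chartDeriv_chartSymmDeriv (hx : x ∈ (extChartAt 𝓘(ℝ, E) x₀).source) (u : E) :
    chartDeriv x₀ x (chartSymmDeriv x₀ (extChartAt 𝓘(ℝ, E) x₀ x) u) = u := by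
  have : IsManifold 𝓘(ℝ, E) 1 M := IsManifold.of_le (n := ∞) (by simp)
  have := mfderiv_extChartAt_comp_mfderivWithin_extChartAt_symm' (I := 𝓘(ℝ, E)) hx
  rw [ModelWithCorners.range_eq_univ, mfderivWithin_univ] at this
  exact DFunLike.congr_fun this u

theorem chartDeriv_self (x : M) (u : E) : chartDeriv x x u = u := by
  have : IsManifold 𝓘(ℝ, E) 1 M := IsManifold.of_le (n := ∞) (by simp)
  have := mfderiv_extChartAt_self (I := 𝓘(ℝ, E)) (x := x)
  exact DFunLike.congr_fun this u

theorem contMDiffOn_extChartAt_source (x₀ : M) :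
    ContMDiffOn 𝓘(ℝ, E) 𝓘(ℝ, E) ∞ (extChartAt 𝓘(ℝ, E) x₀) (extChartAt 𝓘(ℝ, E) x₀).source := by
  rw [extChartAt_source]
  exact contMDiffOn_extChartAt

theorem contMDiffAt_extChartAt_of_mem (hx : x ∈ (extChartAt 𝓘(ℝ, E) x₀).source) :
    ContMDiffAt 𝓘(ℝ, E) 𝓘(ℝ, E) ∞ (extChartAt 𝓘(ℝ, E) x₀) x :=
  (contMDiffOn_extChartAt_source x₀).contMDiffAt ((isOpen_extChartAt_source x₀).mem_nhds hx)

theorem mdifferentiableAt_extChartAt_of_mem (hx : x ∈ (extChartAt 𝓘(ℝ, E) x₀).source) :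
    MDifferentiableAt 𝓘(ℝ, E) 𝓘(ℝ, E) (extChartAt 𝓘(ℝ, E) x₀) x :=
  (contMDiffAt_extChartAt_of_mem hx).mdifferentiableAt (by simp)

theorem contMDiffAt_symm_of_mem (hy : y ∈ (extChartAt 𝓘(ℝ, E) x₀).target) :
    ContMDiffAt 𝓘(ℝ, E) 𝓘(ℝ, E) ∞ (extChartAt 𝓘(ℝ, E) x₀).symm y :=
  (contMDiffOn_extChartAt_symm x₀).contMDiffAt ((isOpen_extChartAt_target x₀).mem_nhds hy)

/-- The coordinate vector fields are smooth. -/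
theorem contMDiffOn_coordinate_field (x₀ : M) (u : E) :
    ContMDiffOn 𝓘(ℝ, E) 𝓘(ℝ, E).tangent ∞
      (fun y : E ↦ (⟨(extChartAt 𝓘(ℝ, E) x₀).symm y,
        mfderiv 𝓘(ℝ, E) 𝓘(ℝ, E) (extChartAt 𝓘(ℝ, E) x₀).symm y u⟩ : TangentBundle 𝓘(ℝ, E) M))
      (extChartAt 𝓘(ℝ, E) x₀).target := by
  have hopen := isOpen_extChartAt_target (I := 𝓘(ℝ, E)) x₀
  have h1 := (contMDiffOn_extChartAt_symm (I := 𝓘(ℝ, E)) (n := ∞) x₀).contMDiffOn_tangentMapWithin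
    (m := ∞) (by simp) hopen.uniqueMDiffOn
  have h2 : ContMDiff 𝓘(ℝ, E) 𝓘(ℝ, E).tangent ∞
      (fun y : E ↦ (⟨y, u⟩ : TangentBundle 𝓘(ℝ, E) E)) := by
    exact contMDiff_vectorSpace_iff_contDiff.2 contDiff_const
  refine (h1.comp h2.contMDiffOn (s := (extChartAt 𝓘(ℝ, E) x₀).target) fun y hy ↦ hy).congr ?_
  intro y hy
  simp only [Function.comp_apply, tangentMapWithin, mfderivWithin_of_isOpen hopen hy]

theorem contDiffOn_fieldInChart {V : ∀ x : M, TangentSpace 𝓘(ℝ, E) x}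
    (hV : ContMDiff 𝓘(ℝ, E) 𝓘(ℝ, E).tangent ∞ (fun x ↦ (⟨x, V x⟩ : TangentBundle 𝓘(ℝ, E) M)))
    (x₀ : M) : ContDiffOn ℝ ∞ (fieldInChart V x₀) (extChartAt 𝓘(ℝ, E) x₀).target := by
  have hopen := isOpen_extChartAt_source (I := 𝓘(ℝ, E)) x₀
  have h1 := (contMDiffOn_extChartAt_source (E := E) x₀).contMDiffOn_tangentMapWithin
    (m := ∞) (by simp) hopen.uniqueMDiffOn
  have h2 := h1.comp (hV.contMDiffOn (s := (extChartAt 𝓘(ℝ, E) x₀).source)) fun y hy ↦ hy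
  have h3 := h2.comp (contMDiffOn_extChartAt_symm (I := 𝓘(ℝ, E)) (n := ∞) x₀)
    (fun y hy ↦ (extChartAt 𝓘(ℝ, E) x₀).map_target hy)
  have h4 := ((contMDiff_snd_tangentBundle_modelSpace E 𝓘(ℝ, E)).comp_contMDiffOn h3).contDiffOn
  refine h4.congr fun z hz ↦ ?_
  have hz' := mfderivWithin_of_isOpen (I := 𝓘(ℝ, E)) (I' := 𝓘(ℝ, E))
    (f := extChartAt 𝓘(ℝ, E) x₀) hopen ((extChartAt 𝓘(ℝ, E) x₀).map_target hz)
  exact (DFunLike.congr_fun hz' _).symm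

/-- The value of a vector field, as an element of the model space. -/
def modelField (V : ∀ x : M, TangentSpace 𝓘(ℝ, E) x) (x : M) : E := V x

theorem fieldInChart_apply (V : ∀ x : M, TangentSpace 𝓘(ℝ, E) x)
    (hx : x ∈ (extChartAt 𝓘(ℝ, E) x₀).source) :
    fieldInChart V x₀ (extChartAt 𝓘(ℝ, E) x₀ x) = chartDeriv x₀ x (modelField V x) := by
  rw [fieldInChart, (extChartAt 𝓘(ℝ, E) x₀).left_inv hx]
  rfl

variable (g : LorentzMetric E M)

/-- The metric at `x`, as a bilinear form on the model space. -/
noncomputable def form (x : M) : E →L[ℝ] E →L[ℝ] ℝ := g.val x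

theorem inChart_apply (x₀ : M) (y u w : E) :
    g.inChart x₀ y u w = g.form ((extChartAt 𝓘(ℝ, E) x₀).symm y)
      (chartSymmDeriv x₀ y u) (chartSymmDeriv x₀ y w) := rfl

theorem form_eq_inChart (hx : x ∈ (extChartAt 𝓘(ℝ, E) x₀).source) (u w : E) :
    g.form x u w
      = g.inChart x₀ (extChartAt 𝓘(ℝ, E) x₀ x) (chartDeriv x₀ x u) (chartDeriv x₀ x w) := by
  rw [inChart_apply, chartSymmDeriv_chartDeriv hx, chartSymmDeriv_chartDeriv hx,
    (extChartAt 𝓘(ℝ, E) x₀).left_inv hx]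

theorem isLorentzForm_form (x : M) : IsLorentzForm (g.form x) :=
  ⟨g.symm x, g.lorentzian x⟩

theorem isLorentzForm_inChart (hy : y ∈ (extChartAt 𝓘(ℝ, E) x₀).target) :
    IsLorentzForm (g.inChart x₀ y) := by
  obtain ⟨x, hx, rfl⟩ : ∃ x ∈ (extChartAt 𝓘(ℝ, E) x₀).source, extChartAt 𝓘(ℝ, E) x₀ x = y :=
    ⟨_, (extChartAt 𝓘(ℝ, E) x₀).map_target hy, (extChartAt 𝓘(ℝ, E) x₀).right_inv hy⟩
  refine ⟨fun u w ↦ g.symm _ _ _, ?_⟩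
  obtain ⟨T, hT, hT'⟩ := (g.isLorentzForm_form x).exists_timelike
  refine ⟨chartDeriv x₀ x T, ?_, fun w hw hw0 ↦ ?_⟩
  · rwa [← g.form_eq_inChart hx]
  · have h1 := chartDeriv_chartSymmDeriv hx w
    rw [← h1, ← g.form_eq_inChart hx] at hw ⊢
    refine hT' _ hw fun h0 ↦ hw0 ?_
    rw [← h1, h0, map_zero]

variable [FiniteDimensional ℝ E]

/-- In finite dimension smoothness can be tested on fixed u and w, where the component is the smooth
section g evaluated on two smooth coordinate vector fields. -/
theorem contDiffOn_inChart (x₀ : M) :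
    ContDiffOn ℝ ∞ (g.inChart x₀) (extChartAt 𝓘(ℝ, E) x₀).target := by
  rw [contDiffOn_clm_apply]
  intro u
  rw [contDiffOn_clm_apply]
  intro w
  have hu := contMDiffOn_coordinate_field x₀ u
  have hw := contMDiffOn_coordinate_field x₀ w
  intro y hy
  have hg : ContMDiffWithinAt 𝓘(ℝ, E) (𝓘(ℝ, E).prod 𝓘(ℝ, E →L[ℝ] E →L[ℝ] ℝ)) ∞
      (fun y : E ↦ TotalSpace.mk' (E →L[ℝ] E →L[ℝ] ℝ)
        (E := fun (x : M) ↦ (TangentSpace 𝓘(ℝ, E) x →L[ℝ] TangentSpace 𝓘(ℝ, E) x →L[ℝ]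
          Bundle.Trivial M ℝ x))
        ((extChartAt 𝓘(ℝ, E) x₀).symm y)
        (g.val ((extChartAt 𝓘(ℝ, E) x₀).symm y))) (extChartAt 𝓘(ℝ, E) x₀).target y :=
    g.contMDiff.contMDiffAt.comp_contMDiffWithinAt y
      (contMDiffOn_extChartAt_symm (I := 𝓘(ℝ, E)) (n := ∞) x₀ y hy)
  have h : ContMDiffWithinAt 𝓘(ℝ, E) (𝓘(ℝ, E).prod 𝓘(ℝ, ℝ)) ∞
      (fun y : E ↦ TotalSpace.mk' ℝ (E := Bundle.Trivial M ℝ)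
        ((extChartAt 𝓘(ℝ, E) x₀).symm y) (g.inChart x₀ y u w))
      (extChartAt 𝓘(ℝ, E) x₀).target y :=
    ContMDiffWithinAt.clm_bundle_apply₂ (F₁ := E) (F₂ := E) hg (hu y hy) (hw y hy)
  rw [contMDiffWithinAt_totalSpace] at h
  exact h.2.contDiffWithinAt

theorem killingData {V : ∀ x : M, TangentSpace 𝓘(ℝ, E) x} (hV : g.IsKilling V) (x₀ : M) :
    KillingData (extChartAt 𝓘(ℝ, E) x₀).target (g.inChart x₀) (fieldInChart V x₀) where
  isOpen := isOpen_extChartAt_target x₀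
  contDiffOn_metric := g.contDiffOn_inChart x₀
  contDiffOn_field := contDiffOn_fieldInChart hV.1 x₀
  symm := fun _ hy ↦ (g.isLorentzForm_inChart hy).symm
  killing := hV.2 x₀

/-- Lowering the index removes the inverse metric, so the geodesic equation can be compared with the
Killing equation by linear arithmetic. -/
theorem inChart_christoffel_self (hy : y ∈ (extChartAt 𝓘(ℝ, E) x₀).target) (u w : E) :
    g.inChart x₀ y (g.christoffel x₀ y u u) w
      = fderiv ℝ (g.inChart x₀) y u u w - (1 / 2) * fderiv ℝ (g.inChart x₀) y w u u := by
  rw [christoffel, (g.isLorentzForm_inChart hy).apply_inverse]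
  simp
  ring

end Charts

end LorentzMetric

/-! ### Second derivatives at critical points and at minima. -/

section SecondDerivative

variable {E : Type*} [NormedAddCommGroup E] [NormedSpace ℝ E]

/-- At a critical point the second derivative transforms as a tensor. -/
theorem fderiv_fderiv_comp_of_fderiv_eq_zero {f : E → ℝ} {ψ : E → E} {y : E}
    (hψ : ContDiffAt ℝ ∞ ψ y) (hf : ContDiffAt ℝ ∞ f (ψ y)) (h0 : fderiv ℝ f (ψ y) = 0) (u w : E) :
    fderiv ℝ (fderiv ℝ (f ∘ ψ)) y u w
      = fderiv ℝ (fderiv ℝ f) (ψ y) (fderiv ℝ ψ y u) (fderiv ℝ ψ y w) := by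
  have hev : fderiv ℝ (f ∘ ψ) =ᶠ[𝓝 y] fun z ↦ (fderiv ℝ f (ψ z)).comp (fderiv ℝ ψ z) := by
    have e1 := (hψ.of_le two_le_infty).eventually (by simp)
    have e2 := hψ.continuousAt.eventually ((hf.of_le two_le_infty).eventually (by simp))
    filter_upwards [e1, e2] with z h1 h2
    exact fderiv_comp z (h2.differentiableAt (by simp)) (h1.differentiableAt (by simp))
  have d1 := (((hf.fderiv_right (m := ∞) (by simp)).differentiableAt (by simp)).hasFDerivAt).comp y
    (hψ.differentiableAt (by simp)).hasFDerivAt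
  have d2 := ((hψ.fderiv_right (m := ∞) (by simp)).differentiableAt (by simp)).hasFDerivAt
  have := (d1.clm_comp d2).congr_of_eventuallyEq hev
  rw [this.fderiv]
  simp [h0]

/-- The second derivative is positive semidefinite at a local minimum. -/
theorem IsLocalMin.fderiv_fderiv_nonneg {f : E → ℝ} {y : E} (h : IsLocalMin f y)
    (hf : ContDiffAt ℝ ∞ f y) (u : E) : 0 ≤ fderiv ℝ (fderiv ℝ f) y u u := by
  by_contra! hneg
  set l : ℝ → E := fun t ↦ y + t • u with hl
  have hl0 : l 0 = y := by simp [hl]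
  have hld : ∀ t, HasDerivAt l u t := fun t ↦ by
    have h1 := ((hasDerivAt_id t).smul_const u).const_add y
    rwa [one_smul] at h1
  have hlc : ContinuousAt l 0 := (hld 0).continuousAt
  have e1 := (hf.of_le two_le_infty).eventually (by simp)
  rw [← hl0] at e1
  have hd : deriv (f ∘ l) =ᶠ[𝓝 0] fun t ↦ fderiv ℝ f (l t) u := by
    filter_upwards [hlc.eventually e1] with t ht
    exact ((ht.differentiableAt (by simp)).hasFDerivAt.comp_hasDerivAt t (hld t)).deriv
  have hdd : deriv (deriv (f ∘ l)) 0 = fderiv ℝ (fderiv ℝ f) y u u := by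
    rw [hd.deriv_eq]
    have h1 : HasFDerivAt (fderiv ℝ f) (fderiv ℝ (fderiv ℝ f) y) (l 0) := by
      rw [hl0]
      exact ((hf.fderiv_right (m := ∞) (by simp)).differentiableAt (by simp)).hasFDerivAt
    simpa using ((h1.comp_hasDerivAt 0 (hld 0)).clm_apply (hasDerivAt_const 0 u)).deriv
  have hmin : IsLocalMin (f ∘ l) 0 := by
    rw [← hl0] at h
    exact h.comp_continuous hlc
  -- A negative second derivative would make the minimum also a maximum along the line l; f would
  -- then be locally constant there, with second derivative zero.
  have hmax : IsLocalMax (f ∘ l) 0 := by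
    refine isLocalMax_of_deriv_deriv_neg (hdd ▸ hneg) hmin.deriv_eq_zero ?_
    exact ContinuousAt.comp (by rw [hl0]; exact hf.continuousAt) hlc
  have hconst : f ∘ l =ᶠ[𝓝 0] fun _ ↦ (f ∘ l) 0 := by
    filter_upwards [hmin, hmax] with t h1 h2 using le_antisymm h2 h1
  have : deriv (deriv (f ∘ l)) 0 = 0 := by
    rw [hconst.deriv.deriv_eq]
    simp
  linarith

end SecondDerivative

/-! ### The potential -V²/2 and its Hessian on the extremal locus. -/

namespace LorentzMetric

section Potential

variable {E : Type*} [NormedAddCommGroup E] [NormedSpace ℝ E]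
  {M : Type*} [TopologicalSpace M] [ChartedSpace E M] [IsManifold 𝓘(ℝ, E) ∞ M]
  {x₀ x : M} {y : E} (g : LorentzMetric E M) {V : ∀ x : M, TangentSpace 𝓘(ℝ, E) x}

theorem hasDerivAt_extChartAt_comp {c : ℝ → M} {t : ℝ}
    (hc : MDifferentiableAt 𝓘(ℝ, ℝ) 𝓘(ℝ, E) c t)
    (hx : c t ∈ (extChartAt 𝓘(ℝ, E) x₀).source) :
    HasDerivAt (fun τ ↦ extChartAt 𝓘(ℝ, E) x₀ (c τ))
      (chartDeriv (E := E) x₀ (c t) (velocity (E := E) c t)) t := by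
  have h : HasFDerivAt (extChartAt 𝓘(ℝ, E) x₀ ∘ c) ((chartDeriv (E := E) x₀ (c t)).comp
      (mfderiv 𝓘(ℝ, ℝ) 𝓘(ℝ, E) c t : ℝ →L[ℝ] E)) t :=
    hasMFDerivAt_iff_hasFDerivAt.1
      ((mdifferentiableAt_extChartAt_of_mem hx).hasMFDerivAt.comp t hc.hasMFDerivAt)
  exact h.hasDerivAt

theorem contDiffAt_comp_symm {F : M → ℝ} (hx : x ∈ (extChartAt 𝓘(ℝ, E) x₀).source)
    (hF : ContMDiffAt 𝓘(ℝ, E) 𝓘(ℝ, ℝ) ∞ F x) :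
    ContDiffAt ℝ ∞ (F ∘ (extChartAt 𝓘(ℝ, E) x₀).symm) (extChartAt 𝓘(ℝ, E) x₀ x) := by
  rw [← contMDiffAt_iff_contDiffAt]
  refine ContMDiffAt.comp _ ?_ (contMDiffAt_symm_of_mem ((extChartAt 𝓘(ℝ, E) x₀).map_source hx))
  rwa [(extChartAt 𝓘(ℝ, E) x₀).left_inv hx]

/-- The differential of a function in a chart. -/
theorem fderiv_comp_symm_chartDeriv {F : M → ℝ} (hx : x ∈ (extChartAt 𝓘(ℝ, E) x₀).source)
    (hF : ContMDiffAt 𝓘(ℝ, E) 𝓘(ℝ, ℝ) ∞ F x) (u : E) :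
    fderiv ℝ (F ∘ (extChartAt 𝓘(ℝ, E) x₀).symm) (extChartAt 𝓘(ℝ, E) x₀ x) (chartDeriv x₀ x u)
      = (mfderiv 𝓘(ℝ, E) 𝓘(ℝ, ℝ) F x : E →L[ℝ] ℝ) u := by
  have h1 : HasMFDerivAt 𝓘(ℝ, E) 𝓘(ℝ, ℝ) (F ∘ (extChartAt 𝓘(ℝ, E) x₀).symm)
      (extChartAt 𝓘(ℝ, E) x₀ x)
      (fderiv ℝ (F ∘ (extChartAt 𝓘(ℝ, E) x₀).symm) (extChartAt 𝓘(ℝ, E) x₀ x)) :=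
    ((contDiffAt_comp_symm hx hF).differentiableAt (by simp)).hasFDerivAt.hasMFDerivAt
  have h2 := h1.comp x (mdifferentiableAt_extChartAt_of_mem hx).hasMFDerivAt
  have h3 : F =ᶠ[𝓝 x] (F ∘ (extChartAt 𝓘(ℝ, E) x₀).symm) ∘ extChartAt 𝓘(ℝ, E) x₀ := by
    filter_upwards [(isOpen_extChartAt_source x₀).mem_nhds hx] with z hz
    simp only [Function.comp_apply]
    rw [(extChartAt 𝓘(ℝ, E) x₀).left_inv hz]
  exact (DFunLike.congr_fun (h2.congr_of_eventuallyEq h3).mfderiv u).symm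

theorem fderiv_comp_symm_eq_zero_iff {F : M → ℝ} (hx : x ∈ (extChartAt 𝓘(ℝ, E) x₀).source)
    (hF : ContMDiffAt 𝓘(ℝ, E) 𝓘(ℝ, ℝ) ∞ F x) :
    fderiv ℝ (F ∘ (extChartAt 𝓘(ℝ, E) x₀).symm) (extChartAt 𝓘(ℝ, E) x₀ x) = 0
      ↔ mfderiv 𝓘(ℝ, E) 𝓘(ℝ, ℝ) F x = 0 := by
  constructor
  · intro h
    refine ContinuousLinearMap.ext fun u ↦ ?_
    refine (fderiv_comp_symm_chartDeriv hx hF u).symm.trans ?_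
    rw [h]
    rfl
  · intro h
    ext u
    rw [← chartDeriv_chartSymmDeriv hx u, fderiv_comp_symm_chartDeriv hx hF, h]
    rfl

/-- The Hessian at a critical point is the second derivative in any chart. -/
theorem hessian_eq_of_critical {F : M → ℝ} (hx : x ∈ (extChartAt 𝓘(ℝ, E) x₀).source)
    (hF : ContMDiffAt 𝓘(ℝ, E) 𝓘(ℝ, ℝ) ∞ F x) (h0 : mfderiv 𝓘(ℝ, E) 𝓘(ℝ, ℝ) F x = 0) (u w : E) :
    g.hessian F x u w = fderiv ℝ (fderiv ℝ (F ∘ (extChartAt 𝓘(ℝ, E) x₀).symm))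
      (extChartAt 𝓘(ℝ, E) x₀ x) (chartDeriv x₀ x u) (chartDeriv x₀ x w) := by
  have hxx := mem_extChartAt_source (I := 𝓘(ℝ, E)) x
  have hxt := (extChartAt 𝓘(ℝ, E) x).map_source hxx
  have hinv := (extChartAt 𝓘(ℝ, E) x).left_inv hxx
  -- ψ is the transition map between the two charts; at a critical point the Christoffel term and
  -- the second derivative of ψ both drop out.
  set ψ : E → E := extChartAt 𝓘(ℝ, E) x₀ ∘ (extChartAt 𝓘(ℝ, E) x).symm with hψ
  set yx := extChartAt 𝓘(ℝ, E) x x with hyx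
  have hψy : ψ yx = extChartAt 𝓘(ℝ, E) x₀ x := by rw [hψ, Function.comp_apply, hinv]
  have hM : MDifferentiableAt 𝓘(ℝ, E) 𝓘(ℝ, E) (extChartAt 𝓘(ℝ, E) x₀)
      ((extChartAt 𝓘(ℝ, E) x).symm yx) := by
    rw [hinv]; exact mdifferentiableAt_extChartAt_of_mem hx
  have hψc : ContDiffAt ℝ ∞ ψ yx := by
    rw [← contMDiffAt_iff_contDiffAt]
    refine ContMDiffAt.comp _ ?_ (contMDiffAt_symm_of_mem hxt)
    rw [hinv]
    exact contMDiffAt_extChartAt_of_mem hx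
  have hψd : ∀ a, fderiv ℝ ψ yx a = chartDeriv x₀ x a := by
    intro a
    have h2 : HasFDerivAt ψ ((chartDeriv x₀ ((extChartAt 𝓘(ℝ, E) x).symm yx)).comp
        (chartSymmDeriv x yx)) yx := hasMFDerivAt_iff_hasFDerivAt.1 (hM.hasMFDerivAt.comp yx
      ((contMDiffAt_symm_of_mem hxt).mdifferentiableAt (by simp)).hasMFDerivAt)
    have h3 : fderiv ℝ ψ yx a = chartDeriv x₀ ((extChartAt 𝓘(ℝ, E) x).symm yx)
      (chartSymmDeriv x yx a) := DFunLike.congr_fun h2.fderiv a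
    have h4 := chartSymmDeriv_chartDeriv hxx a
    rw [chartDeriv_self] at h4
    rw [h3, hinv, h4]
  have hcomp : F ∘ (extChartAt 𝓘(ℝ, E) x).symm
      =ᶠ[𝓝 yx] (F ∘ (extChartAt 𝓘(ℝ, E) x₀).symm) ∘ ψ := by
    have hc := (contMDiffAt_symm_of_mem (E := E) hxt).continuousAt
    have hm : (extChartAt 𝓘(ℝ, E) x₀).source ∈ 𝓝 ((extChartAt 𝓘(ℝ, E) x).symm yx) := by
      rw [hinv]; exact (isOpen_extChartAt_source x₀).mem_nhds hx
    filter_upwards [hc hm] with z hz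
    simp only [Function.comp_apply, hψ]
    rw [(extChartAt 𝓘(ℝ, E) x₀).left_inv hz]
  have hz : fderiv ℝ (F ∘ (extChartAt 𝓘(ℝ, E) x).symm) yx = 0 :=
    (fderiv_comp_symm_eq_zero_iff hxx hF).2 h0
  change fderiv ℝ (fderiv ℝ (F ∘ (extChartAt 𝓘(ℝ, E) x).symm)) yx u w
    - fderiv ℝ (F ∘ (extChartAt 𝓘(ℝ, E) x).symm) yx _ = _
  rw [hz, hcomp.fderiv.fderiv_eq, fderiv_fderiv_comp_of_fderiv_eq_zero hψc, hψd, hψd, hψy]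
  · simp
  · rw [hψy]; exact contDiffAt_comp_symm hx hF
  · rw [hψy]; exact (fderiv_comp_symm_eq_zero_iff hx hF).2 h0

/-- The square of the field in a chart. -/
noncomputable def sqInChart (V : ∀ x : M, TangentSpace 𝓘(ℝ, E) x) (x₀ : M) (y : E) : ℝ :=
  g.inChart x₀ y (fieldInChart V x₀ y) (fieldInChart V x₀ y)

theorem normSq_eq_sqInChart (hx : x ∈ (extChartAt 𝓘(ℝ, E) x₀).source) :
    g.normSq V x = g.sqInChart V x₀ (extChartAt 𝓘(ℝ, E) x₀ x) := by
  rw [sqInChart, fieldInChart_apply V hx]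
  exact g.form_eq_inChart hx (modelField V x) (modelField V x)

theorem normSq_comp_symm (hy : y ∈ (extChartAt 𝓘(ℝ, E) x₀).target) :
    (g.normSq V ∘ (extChartAt 𝓘(ℝ, E) x₀).symm) =ᶠ[𝓝 y] g.sqInChart V x₀ := by
  filter_upwards [(isOpen_extChartAt_target x₀).mem_nhds hy] with z hz
  rw [Function.comp_apply, g.normSq_eq_sqInChart ((extChartAt 𝓘(ℝ, E) x₀).map_target hz),
    (extChartAt 𝓘(ℝ, E) x₀).right_inv hz]

theorem potential_comp_symm (hy : y ∈ (extChartAt 𝓘(ℝ, E) x₀).target) :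
    (g.potential V ∘ (extChartAt 𝓘(ℝ, E) x₀).symm) =ᶠ[𝓝 y]
      fun z ↦ -(1 / 2 : ℝ) • g.sqInChart V x₀ z := by
  filter_upwards [g.normSq_comp_symm (V := V) hy] with z hz
  simp only [Function.comp_apply, potential] at hz ⊢
  rw [hz, smul_eq_mul]
  ring

variable [FiniteDimensional ℝ E]

theorem contDiffAt_sqInChart (hV : g.IsKilling V) (hy : y ∈ (extChartAt 𝓘(ℝ, E) x₀).target) :
    ContDiffAt ℝ ∞ (g.sqInChart V x₀) y :=
  (g.killingData hV x₀).contDiffAt_sq hy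

theorem contMDiff_normSq (hV : g.IsKilling V) :
    ContMDiff 𝓘(ℝ, E) 𝓘(ℝ, ℝ) ∞ (g.normSq V) := fun x ↦ by
  have hx := mem_extChartAt_source (I := 𝓘(ℝ, E)) x
  have h1 : ContMDiffAt 𝓘(ℝ, E) 𝓘(ℝ, ℝ) ∞ (g.sqInChart V x) (extChartAt 𝓘(ℝ, E) x x) :=
    (g.contDiffAt_sqInChart hV ((extChartAt 𝓘(ℝ, E) x).map_source hx)).contMDiffAt
  refine (h1.comp x (contMDiffAt_extChartAt_of_mem hx)).congr_of_eventuallyEq ?_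
  filter_upwards [(isOpen_extChartAt_source x).mem_nhds hx] with z hz
  exact g.normSq_eq_sqInChart hz

theorem contMDiff_potential (hV : g.IsKilling V) :
    ContMDiff 𝓘(ℝ, E) 𝓘(ℝ, ℝ) ∞ (g.potential V) := fun x ↦ by
  have h : ContDiff ℝ ∞ fun r : ℝ ↦ -r / 2 := by fun_prop
  exact h.contMDiff.contMDiffAt.comp x (g.contMDiff_normSq hV x)

theorem mem_extremalLocus_iff (hV : g.IsKilling V) (hx : x ∈ (extChartAt 𝓘(ℝ, E) x₀).source) :
    x ∈ g.extremalLocus V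
      ↔ fderiv ℝ (g.sqInChart V x₀) (extChartAt 𝓘(ℝ, E) x₀ x) = 0 := by
  rw [← (g.normSq_comp_symm ((extChartAt 𝓘(ℝ, E) x₀).map_source hx)).fderiv_eq,
    fderiv_comp_symm_eq_zero_iff hx (g.contMDiff_normSq hV x)]
  rfl

theorem mfderiv_potential_eq_zero (hV : g.IsKilling V) (hx : x ∈ g.extremalLocus V) :
    mfderiv 𝓘(ℝ, E) 𝓘(ℝ, ℝ) (g.potential V) x = 0 := by
  have hxx := mem_extChartAt_source (I := 𝓘(ℝ, E)) x
  have hxt := (extChartAt 𝓘(ℝ, E) x).map_source hxx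
  rw [← fderiv_comp_symm_eq_zero_iff hxx (g.contMDiff_potential hV x),
    (g.potential_comp_symm hxt).fderiv_eq,
    fderiv_fun_const_smul ((g.contDiffAt_sqInChart hV hxt).differentiableAt (by simp)),
    (g.mem_extremalLocus_iff hV hxx).1 hx, smul_zero]

/-- The Hessian of the potential on the extremal locus, in a chart. -/
theorem hessian_potential (hV : g.IsKilling V) (hx : x ∈ (extChartAt 𝓘(ℝ, E) x₀).source)
    (hxT : x ∈ g.extremalLocus V) (u w : E) :
    g.hessian (g.potential V) x u w = -(1 / 2) * fderiv ℝ (fderiv ℝ (g.sqInChart V x₀))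
      (extChartAt 𝓘(ℝ, E) x₀ x) (chartDeriv x₀ x u) (chartDeriv x₀ x w) := by
  have hxt := (extChartAt 𝓘(ℝ, E) x₀).map_source hx
  have hev : fderiv ℝ (fun z ↦ -(1 / 2 : ℝ) • g.sqInChart V x₀ z)
      =ᶠ[𝓝 (extChartAt 𝓘(ℝ, E) x₀ x)] fun z ↦ -(1 / 2 : ℝ) • fderiv ℝ (g.sqInChart V x₀) z := by
    filter_upwards [(isOpen_extChartAt_target x₀).mem_nhds hxt] with z hz
    exact fderiv_fun_const_smul ((g.contDiffAt_sqInChart hV hz).differentiableAt (by simp)) _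
  rw [g.hessian_eq_of_critical hx (g.contMDiff_potential hV x) (g.mfderiv_potential_eq_zero hV hxT),
    (g.potential_comp_symm hxt).fderiv.fderiv_eq, hev.fderiv_eq, fderiv_fun_const_smul]
  · simp
  · exact ((g.contDiffAt_sqInChart hV hxt).fderiv_right (m := ∞) (by simp)).differentiableAt
      (by simp)

theorem hessian_potential_symm (hV : g.IsKilling V) (hxT : x ∈ g.extremalLocus V) (u w : E) :
    g.hessian (g.potential V) x u w = g.hessian (g.potential V) x w u := by
  have hx := mem_extChartAt_source (I := 𝓘(ℝ, E)) x
  rw [g.hessian_potential hV hx hxT, g.hessian_potential hV hx hxT]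
  congr 1
  exact (g.killingData hV x).fderiv_fderiv_sq_symm ((extChartAt 𝓘(ℝ, E) x).map_source hx) _ _

theorem hessian_potential_nonneg (hV : g.IsKilling V) (hxT : x ∈ g.extremalLocus V)
    (hmin : IsLocalMin (g.potential V) x) (u : E) : 0 ≤ g.hessian (g.potential V) x u u := by
  have hx := mem_extChartAt_source (I := 𝓘(ℝ, E)) x
  rw [g.hessian_eq_of_critical hx (g.contMDiff_potential hV x) (g.mfderiv_potential_eq_zero hV hxT)]
  refine IsLocalMin.fderiv_fderiv_nonneg ?_
    (contDiffAt_comp_symm hx (g.contMDiff_potential hV x)) _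
  rw [← (extChartAt 𝓘(ℝ, E) x).left_inv hx] at hmin
  exact hmin.comp_continuous
    (contMDiffAt_symm_of_mem ((extChartAt 𝓘(ℝ, E) x).map_source hx)).continuousAt

/-- The vectors tangent to the extremal locus are in the kernel of the Hessian. -/
theorem hessian_potential_tangentTo (hV : g.IsKilling V) (hxT : x ∈ g.extremalLocus V) {u : E}
    (hu : u ∈ tangentTo (E := E) (g.extremalLocus V) x) (w : E) :
    g.hessian (g.potential V) x u w = 0 := by
  have hx := mem_extChartAt_source (I := 𝓘(ℝ, E)) x
  have hxt := (extChartAt 𝓘(ℝ, E) x).map_source hx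
  rw [g.hessian_potential hV hx hxT, chartDeriv_self, chartDeriv_self]
  suffices h : fderiv ℝ (fderiv ℝ (g.sqInChart V x)) (extChartAt 𝓘(ℝ, E) x x) u = 0 by
    rw [h, zero_apply, mul_zero]
  refine Submodule.span_induction (p := fun (u : E) _ ↦
    fderiv ℝ (fderiv ℝ (g.sqInChart V x)) (extChartAt 𝓘(ℝ, E) x x) u = 0) ?_ (map_zero _) ?_ ?_ hu
  · rintro _ ⟨c, rfl, hc, hcT, rfl⟩
    have hd1 := (hasDerivAt_extChartAt_comp (x₀ := c 0) (hc.mdifferentiableAt (by simp))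
      hx).congr_deriv (chartDeriv_self (c 0) _)
    -- Along a curve in the locus d(V²) is identically zero, so its derivative in the direction of
    -- the velocity vanishes.
    have hd2 := ((g.killingData hV (c 0)).hasFDerivAt_fderiv_sq hxt).comp_hasDerivAt
      (0 : ℝ) hd1
    refine hd2.unique ((hasDerivAt_const (0 : ℝ) (0 : E →L[ℝ] ℝ)).congr_of_eventuallyEq ?_)
    filter_upwards [hcT, hc.continuousAt ((isOpen_extChartAt_source (c 0)).mem_nhds hx)]
      with t h1 h2
    exact (g.mem_extremalLocus_iff hV h2).1 h1
  · intro a b _ _ ha hb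
    exact (map_add _ _ _).trans (by rw [ha, hb, add_zero])
  · intro r a _ ha
    exact (map_smul _ _ _).trans (by rw [ha, smul_zero])

end Potential

end LorentzMetric

/-! ### Transport by the linearized flow. -/

/-- The index is quantified inside the filter so that one neighbourhood serves all members: all
pairs of vectors, or all nearby geodesics of the family. -/
theorem eventually_eq_of_hasDerivAt_zero {F : Type*} [NormedAddCommGroup F] [NormedSpace ℝ F]
    {ι : Type*} {f : ι → ℝ → F} {t₀ : ℝ} (h : ∀ᶠ t in 𝓝 t₀, ∀ i, HasDerivAt (f i) 0 t) :
    ∀ᶠ t in 𝓝 t₀, ∀ i, f i t = f i t₀ := by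
  obtain ⟨ε, hε, hb⟩ := Metric.eventually_nhds_iff_ball.1 h
  filter_upwards [Metric.ball_mem_nhds t₀ hε] with t ht i
  exact Metric.isOpen_ball.is_const_of_deriv_eq_zero (convex_ball t₀ ε).isPreconnected
    (fun τ hτ ↦ (hb τ hτ i).differentiableAt.differentiableWithinAt)
    (fun τ hτ ↦ (hb τ hτ i).deriv) ht (Metric.mem_ball_self hε)

section IntegralCurves

variable {E : Type*} [NormedAddCommGroup E] [NormedSpace ℝ E]

/-- Bootstrap: if z is of class Cⁿ, then so is z' = v ∘ z, and z is of class Cⁿ⁺¹. -/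
theorem contDiffOn_of_hasDerivAt_field {v : E → E} {Ω : Set E} (hv : ContDiffOn ℝ ∞ v Ω)
    {I : Set ℝ} (hI : IsOpen I) {z : ℝ → E} (hz : ∀ t ∈ I, HasDerivAt z (v (z t)) t)
    (hzΩ : MapsTo z I Ω) : ContDiffOn ℝ ∞ z I := by
  rw [contDiffOn_infty]
  intro n
  induction n with
  | zero => exact contDiffOn_zero.2 fun t ht ↦ (hz t ht).continuousAt.continuousWithinAt
  | succ n ih =>
    have h := (contDiffOn_succ_iff_deriv_of_isOpen (𝕜 := ℝ) (n := n) (f := z) hI).2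
      ⟨fun t ht ↦ (hz t ht).differentiableAt.differentiableWithinAt, by simp,
        ((hv.of_le (by exact_mod_cast le_top)).comp ih hzΩ).congr fun t ht ↦ (hz t ht).deriv⟩
    exact_mod_cast h

namespace KillingData

variable {Ω : Set E} {G : E → E →L[ℝ] E →L[ℝ] ℝ} {v : E → E} [CompleteSpace E]

/-- Lie transport along an integral curve. -/
theorem exists_transport (h : KillingData Ω G v) {z : ℝ → E} {t₀ : ℝ} (hz₀ : z t₀ ∈ Ω)
    (hz : ∀ᶠ t in 𝓝 t₀, HasDerivAt z (v (z t)) t) :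
    ∃ A : ℝ → E →L[ℝ] E, A t₀ = ContinuousLinearMap.id ℝ E ∧
      ∀ᶠ t in 𝓝 t₀, HasDerivAt A ((fderiv ℝ v (z t)).comp (A t)) t := by
  have hvc := h.contDiffAt_field hz₀
  -- The flow and its linearization are solved as one autonomous system; uniqueness for v then
  -- identifies the first component with the given curve z.
  let W : E × (E →L[ℝ] E) → E × (E →L[ℝ] E) := fun p ↦ (v p.1, (fderiv ℝ v p.1).comp p.2)
  have hW : ContDiffAt ℝ 1 W (z t₀, ContinuousLinearMap.id ℝ E) := by
    have h1 : ContDiffAt ℝ 1 (fun p : E × (E →L[ℝ] E) ↦ v p.1)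
        (z t₀, ContinuousLinearMap.id ℝ E) :=
      ContDiffAt.comp (g := v) _ (hvc.of_le (by simp)) contDiffAt_fst
    have h2 : ContDiffAt ℝ 1 (fun p : E × (E →L[ℝ] E) ↦ fderiv ℝ v p.1)
        (z t₀, ContinuousLinearMap.id ℝ E) :=
      ContDiffAt.comp (g := fderiv ℝ v) _ (hvc.fderiv_right (m := 1)
        (by simpa [one_add_one_eq_two] using two_le_infty)) contDiffAt_fst
    exact h1.prodMk (h2.clm_comp contDiffAt_snd)
  obtain ⟨α, hα₀, ε, hε, hα⟩ :=
    hW.exists_forall_mem_closedBall_exists_eq_forall_mem_Ioo_hasDerivAt₀ t₀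
  have hα' : ∀ᶠ t in 𝓝 t₀, HasDerivAt α (W (α t)) t :=
    mem_of_superset (Ioo_mem_nhds (by linarith) (by linarith)) hα
  obtain ⟨K, s, hs, hK⟩ := (hvc.of_le (by simp : (1 : WithTop ℕ∞) ≤ ∞)).exists_lipschitzOnWith
  have hα1 : ∀ᶠ t in 𝓝 t₀, HasDerivAt (fun t ↦ (α t).1) (v (α t).1) t :=
    hα'.mono fun t ht ↦ (hasFDerivAt_fst.comp_hasDerivAt t ht :)
  have hα2 : ∀ᶠ t in 𝓝 t₀, HasDerivAt (fun t ↦ (α t).2)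
      ((fderiv ℝ v (α t).1).comp (α t).2) t :=
    hα'.mono fun t ht ↦ (hasFDerivAt_snd.comp_hasDerivAt t ht :)
  have hc1 : ∀ᶠ t in 𝓝 t₀, (α t).1 ∈ s := by
    refine hα1.self_of_nhds.continuousAt.eventually ?_
    have h0 : (α t₀).1 = z t₀ := by rw [hα₀]
    change s ∈ 𝓝 (α t₀).1
    rwa [h0]
  have hc2 : ∀ᶠ t in 𝓝 t₀, z t ∈ s := hz.self_of_nhds.continuousAt.eventually hs
  have heq : (fun t ↦ (α t).1) =ᶠ[𝓝 t₀] z :=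
    ODE_solution_unique_of_eventually (v := fun _ ↦ v) (s := fun _ ↦ s) (K := K)
      (Eventually.of_forall fun _ ↦ hK) (hα1.and hc1) (hz.and hc2) (by simp [hα₀])
  refine ⟨fun t ↦ (α t).2, by simp [hα₀], ?_⟩
  filter_upwards [hα2, heq] with t h1 h2
  rwa [← h2]

/-- The Lie transport along an integral curve preserves the metric, the differential of the square
of the Killing field and, where the latter vanishes, its second derivative. -/
theorem exists_transport_equiv (h : KillingData Ω G v) {z : ℝ → E} {t₀ : ℝ} (hz₀ : z t₀ ∈ Ω)
    (hz : ∀ᶠ t in 𝓝 t₀, HasDerivAt z (v (z t)) t) :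
    ∀ᶠ t in 𝓝 t₀,
      (fderiv ℝ (fun y ↦ G y (v y) (v y)) (z t) = 0
        ↔ fderiv ℝ (fun y ↦ G y (v y) (v y)) (z t₀) = 0) ∧
      ∃ A : E ≃L[ℝ] E, (∀ u w, G (z t) (A u) (A w) = G (z t₀) u w) ∧
        (fderiv ℝ (fun y ↦ G y (v y) (v y)) (z t₀) = 0 → ∀ u w,
          fderiv ℝ (fderiv ℝ (fun y ↦ G y (v y) (v y))) (z t) (A u) (A w)
            = fderiv ℝ (fderiv ℝ (fun y ↦ G y (v y) (v y))) (z t₀) u w) := by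
  obtain ⟨A, hA₀, hA⟩ := h.exists_transport hz₀ hz
  set N : E → ℝ := fun y ↦ G y (v y) (v y) with hN
  have hzΩ : ∀ᶠ t in 𝓝 t₀, z t ∈ Ω :=
    hz.self_of_nhds.continuousAt.eventually (h.isOpen.mem_nhds hz₀)
  have hAu : ∀ {t : ℝ}, HasDerivAt A ((fderiv ℝ v (z t)).comp (A t)) t → ∀ u,
      HasDerivAt (fun τ ↦ A τ u) (fderiv ℝ v (z t) (A t u)) t := fun ht u ↦ by
    simpa using ht.clm_apply (hasDerivAt_const _ u)
  have hp : ∀ᶠ t in 𝓝 t₀, (fderiv ℝ N (z t)).comp (A t) = fderiv ℝ N (z t₀) := by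
    have h1 : ∀ᶠ t in 𝓝 t₀, ∀ _ : Unit,
        HasDerivAt (fun τ ↦ (fderiv ℝ N (z τ)).comp (A τ)) 0 t := by
      filter_upwards [hzΩ, hz, hA] with t h1 h2 h3 _
      have := ((h.hasFDerivAt_fderiv_sq h1).comp_hasDerivAt t h2).clm_comp h3
      convert! this using 1
      rw [h.fderiv_fderiv_sq_apply_field h1]
      ext u
      simp
    filter_upwards [eventually_eq_of_hasDerivAt_zero h1] with t ht
    rw [ht (), hA₀, ContinuousLinearMap.comp_id]
  -- A starts at the identity, and invertible operators form an open set.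
  have hunit : ∀ᶠ t in 𝓝 t₀, ∃ e : E ≃L[ℝ] E, (e : E →L[ℝ] E) = A t := by
    have h1 := ContinuousLinearEquiv.nhds (ContinuousLinearEquiv.refl ℝ E)
    rw [ContinuousLinearEquiv.coe_refl, ← hA₀] at h1
    exact hA.self_of_nhds.continuousAt.eventually h1
  have hcrit : ∀ᶠ t in 𝓝 t₀, (fderiv ℝ N (z t) = 0 ↔ fderiv ℝ N (z t₀) = 0) := by
    filter_upwards [hp, hunit] with t h1 ⟨e, he⟩
    rw [← h1, ← he]
    refine ⟨fun h2 ↦ by simp [h2], fun h2 ↦ ?_⟩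
    ext u
    simpa using DFunLike.congr_fun h2 (e.symm u)
  have hG : ∀ᶠ t in 𝓝 t₀, ∀ p : E × E, G (z t) (A t p.1) (A t p.2) = G (z t₀) p.1 p.2 := by
    have h1 : ∀ᶠ t in 𝓝 t₀, ∀ p : E × E,
        HasDerivAt (fun τ ↦ G (z τ) (A τ p.1) (A τ p.2)) 0 t := by
      filter_upwards [hzΩ, hz, hA] with t h1 h2 h3 p
      rw [← h.killing (z t) h1 (A t p.1) (A t p.2)]
      exact h.hasDerivAt_metric_apply h1 h2 (hAu h3 p.1) (hAu h3 p.2)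
    filter_upwards [eventually_eq_of_hasDerivAt_zero h1] with t ht p
    simpa [hA₀] using ht p
  have hH : ∀ᶠ t in 𝓝 t₀, fderiv ℝ N (z t₀) = 0 → ∀ p : E × E,
      fderiv ℝ (fderiv ℝ N) (z t) (A t p.1) (A t p.2)
        = fderiv ℝ (fderiv ℝ N) (z t₀) p.1 p.2 := by
    by_cases h0 : fderiv ℝ N (z t₀) = 0
    · have h1 : ∀ᶠ t in 𝓝 t₀, ∀ p : E × E,
          HasDerivAt (fun τ ↦ fderiv ℝ (fderiv ℝ N) (z τ) (A τ p.1) (A τ p.2)) 0 t := by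
        filter_upwards [hzΩ, hz, hA, hcrit] with t h1 h2 h3 h4 p
        rw [← h.fderiv_fderiv_fderiv_sq_apply_field h1 (h4.2 h0) (A t p.1) (A t p.2)]
        have hd : HasDerivAt (fun τ ↦ fderiv ℝ (fderiv ℝ N) (z τ))
            (fderiv ℝ (fderiv ℝ (fderiv ℝ N)) (z t) (v (z t))) t :=
          ((((h.contDiffAt_sq h1).fderiv_right (m := ∞) (by simp)).fderiv_right (m := ∞)
            (by simp)).differentiableAt (by simp)).hasFDerivAt.comp_hasDerivAt t h2
        exact hd.bilinear_apply (hAu h3 p.1) (hAu h3 p.2)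
      filter_upwards [eventually_eq_of_hasDerivAt_zero h1] with t ht _ p
      simpa [hA₀] using ht p
    · exact Eventually.of_forall fun t h1 ↦ absurd h1 h0
  filter_upwards [hcrit, hunit, hG, hH] with t h1 ⟨e, he⟩ h3 h4
  refine ⟨h1, e, fun u w ↦ ?_, fun h0 u w ↦ ?_⟩
  · have := h3 (u, w)
    rwa [← he] at this
  · have := h4 h0 (u, w)
    rwa [← he] at this

end KillingData

end IntegralCurves

/-! ### Integral curves in the extremal locus are geodesics. -/

namespace LorentzMetric

section IntegralCurves

variable {E : Type*} [NormedAddCommGroup E] [NormedSpace ℝ E] [FiniteDimensional ℝ E]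
  {M : Type*} [TopologicalSpace M] [ChartedSpace E M] [IsManifold 𝓘(ℝ, E) ∞ M]
  {x₀ x : M} (g : LorentzMetric E M) {V : ∀ x : M, TangentSpace 𝓘(ℝ, E) x}
  {γ : ℝ → M} {J : Set ℝ} {t : ℝ}

/-- The derivative of a chart, as a continuous linear equivalence of the model space. -/
noncomputable def chartEquiv (hx : x ∈ (extChartAt 𝓘(ℝ, E) x₀).source) : E ≃L[ℝ] E :=
  ContinuousLinearEquiv.equivOfInverse (chartDeriv x₀ x)
    (chartSymmDeriv x₀ (extChartAt 𝓘(ℝ, E) x₀ x))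
    (chartSymmDeriv_chartDeriv hx) (chartDeriv_chartSymmDeriv hx)

theorem hasMFDerivAt_of_integralCurve (hJ : IsOpen J) (hγ : IsMIntegralCurveOn γ V J)
    (ht : t ∈ J) :
    HasMFDerivAt 𝓘(ℝ, ℝ) 𝓘(ℝ, E) γ t ((1 : ℝ →L[ℝ] ℝ).smulRight (V (γ t))) :=
  (hγ t ht).hasMFDerivAt (hJ.mem_nhds ht)

theorem velocity_integralCurve (hJ : IsOpen J) (hγ : IsMIntegralCurveOn γ V J) (ht : t ∈ J) :
    velocity (E := E) γ t = V (γ t) := by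
  rw [velocity, (hasMFDerivAt_of_integralCurve hJ hγ ht).mfderiv]
  exact one_smul ℝ (V (γ t))

theorem hasDerivAt_integralCurve (hJ : IsOpen J) (hγ : IsMIntegralCurveOn γ V J) (ht : t ∈ J)
    (hx : γ t ∈ (extChartAt 𝓘(ℝ, E) x₀).source) :
    HasDerivAt (fun τ ↦ extChartAt 𝓘(ℝ, E) x₀ (γ τ))
      (fieldInChart V x₀ (extChartAt 𝓘(ℝ, E) x₀ (γ t))) t := by
  have h := hasDerivAt_extChartAt_comp
    (hasMFDerivAt_of_integralCurve hJ hγ ht).mdifferentiableAt hx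
  rw [velocity_integralCurve hJ hγ ht] at h
  rw [fieldInChart_apply V hx]
  exact h

theorem isOpen_inter_preimage_source (hJ : IsOpen J) (hγ : ContinuousOn γ J) (x₀ : M) :
    IsOpen (J ∩ γ ⁻¹' (extChartAt 𝓘(ℝ, E) x₀).source) :=
  hγ.isOpen_inter_preimage hJ (isOpen_extChartAt_source x₀)

theorem eventually_hasDerivAt_integralCurve (hJ : IsOpen J) (hγ : IsMIntegralCurveOn γ V J)
    (ht : t ∈ J) (hx : γ t ∈ (extChartAt 𝓘(ℝ, E) x₀).source) :
    ∀ᶠ τ in 𝓝 t, τ ∈ J ∧ γ τ ∈ (extChartAt 𝓘(ℝ, E) x₀).source ∧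
      HasDerivAt (fun τ ↦ extChartAt 𝓘(ℝ, E) x₀ (γ τ))
        (fieldInChart V x₀ (extChartAt 𝓘(ℝ, E) x₀ (γ τ))) τ := by
  filter_upwards [(isOpen_inter_preimage_source hJ hγ.continuousOn x₀).mem_nhds ⟨ht, hx⟩]
    with τ hτ
  exact ⟨hτ.1, hτ.2, hasDerivAt_integralCurve hJ hγ hτ.1 hτ.2⟩

/-- The flow of a Killing field preserves the extremal locus and, there, the Hessian of the
potential. -/
theorem eventually_exists_transport (hV : g.IsKilling V) (hJ : IsOpen J)
    (hγ : IsMIntegralCurveOn γ V J) (ht : t ∈ J) :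
    ∀ᶠ τ in 𝓝 t, (γ τ ∈ g.extremalLocus V ↔ γ t ∈ g.extremalLocus V) ∧
      (γ t ∈ g.extremalLocus V → ∃ A : E ≃L[ℝ] E,
        (∀ u w, g.form (γ τ) (A u) (A w) = g.form (γ t) u w) ∧
        ∀ u w : E, g.hessian (g.potential V) (γ τ) (A u) (A w)
          = g.hessian (g.potential V) (γ t) u w) := by
  have := FiniteDimensional.complete ℝ E
  have hx := mem_extChartAt_source (I := 𝓘(ℝ, E)) (γ t)
  have hev := eventually_hasDerivAt_integralCurve hJ hγ ht hx
  filter_upwards [hev, (g.killingData hV (γ t)).exists_transport_equiv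
    ((extChartAt 𝓘(ℝ, E) (γ t)).map_source hx) (hev.mono fun τ h ↦ h.2.2)]
    with τ ⟨hτJ, hτ, _⟩ ⟨hcrit, A, hG, hH⟩
  have hiff : γ τ ∈ g.extremalLocus V ↔ γ t ∈ g.extremalLocus V := by
    rw [g.mem_extremalLocus_iff hV hτ, g.mem_extremalLocus_iff hV hx]
    exact hcrit
  -- The transport A lives in the chart at γ t; the inverse chart derivative returns its values to
  -- the tangent space at γ τ, which is identified with E by another chart.
  refine ⟨hiff, fun hT ↦ ⟨A.trans (chartEquiv hτ).symm, ?_, ?_⟩⟩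
  · intro u w
    have h1 := hG u w
    rw [g.form_eq_inChart hτ, g.form_eq_inChart hx, chartDeriv_self, chartDeriv_self, ← h1]
    congr 1
    · exact congrArg _ ((chartEquiv hτ).apply_symm_apply (A u))
    · exact (chartEquiv hτ).apply_symm_apply (A w)
  · intro u w
    have h1 := hH ((g.mem_extremalLocus_iff hV hx).1 hT) u w
    have e1 : chartDeriv (γ t) (γ τ) ((chartEquiv hτ).symm (A u)) = A u :=
      (chartEquiv hτ).apply_symm_apply (A u)
    have e2 : chartDeriv (γ t) (γ τ) ((chartEquiv hτ).symm (A w)) = A w :=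
      (chartEquiv hτ).apply_symm_apply (A w)
    rw [g.hessian_potential hV hτ (hiff.2 hT), g.hessian_potential hV hx hT, chartDeriv_self,
      chartDeriv_self]
    simp only [ContinuousLinearEquiv.trans_apply]
    rw [e1, e2]
    exact congrArg _ h1

/-- Membership is locally constant along the curve, because the linearized flow is invertible and
preserves d(V²); connectedness of J makes it constant. -/
theorem mem_extremalLocus_of_integralCurve (hV : g.IsKilling V) (hJ : IsOpen J)
    (hJc : IsPreconnected J) (hγ : IsMIntegralCurveOn γ V J) {t₀ : ℝ} (ht₀ : t₀ ∈ J)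
    (h₀ : γ t₀ ∈ g.extremalLocus V) (ht : t ∈ J) : γ t ∈ g.extremalLocus V := by
  refine (hJc.induction₂ (fun a b ↦ γ a ∈ g.extremalLocus V ↔ γ b ∈ g.extremalLocus V)
    (fun a ha ↦ ?_) (fun a b c _ _ _ ↦ Iff.trans) (fun a b _ _ ↦ Iff.symm) ht₀ ht).1 h₀
  exact mem_nhdsWithin_of_mem_nhds
    ((g.eventually_exists_transport hV hJ hγ ha).mono fun τ h ↦ h.1.symm)

/-- The integral curves of a Killing field in its extremal locus are geodesics. -/
theorem isGeodesicOn_of_integralCurve (hV : g.IsKilling V) (hJ : IsOpen J)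
    (hγ : IsMIntegralCurveOn γ V J) (hT : ∀ t ∈ J, γ t ∈ g.extremalLocus V) :
    g.IsGeodesicOn γ J := by
  refine ⟨fun t ht ↦ ContMDiffAt.contMDiffWithinAt ?_, fun t ht x₀ hx ↦ ?_⟩
  · have hx := mem_extChartAt_source (I := 𝓘(ℝ, E)) (γ t)
    have hI := isOpen_inter_preimage_source hJ hγ.continuousOn (E := E) (γ t)
    have hz : ContDiffAt ℝ ∞ (fun τ ↦ extChartAt 𝓘(ℝ, E) (γ t) (γ τ)) t :=
      (contDiffOn_of_hasDerivAt_field (contDiffOn_fieldInChart hV.1 (γ t)) hI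
        (fun τ hτ ↦ hasDerivAt_integralCurve hJ hγ hτ.1 hτ.2)
        (fun τ hτ ↦ (extChartAt 𝓘(ℝ, E) (γ t)).map_source hτ.2)).contDiffAt
        (hI.mem_nhds ⟨ht, hx⟩)
    refine ((contMDiffAt_symm_of_mem ((extChartAt 𝓘(ℝ, E) (γ t)).map_source hx)).comp t
      hz.contMDiffAt).congr_of_eventuallyEq ?_
    filter_upwards [hI.mem_nhds ⟨ht, hx⟩] with τ hτ
    exact ((extChartAt 𝓘(ℝ, E) (γ t)).left_inv hτ.2).symm
  · have hd := g.killingData hV x₀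
    have hy := (extChartAt 𝓘(ℝ, E) x₀).map_source hx
    have hz := hasDerivAt_integralCurve hJ hγ ht hx
    have h1 : deriv (fun τ ↦ extChartAt 𝓘(ℝ, E) x₀ (γ τ)) =ᶠ[𝓝 t]
        fun τ ↦ fieldInChart V x₀ (extChartAt 𝓘(ℝ, E) x₀ (γ τ)) :=
      (eventually_hasDerivAt_integralCurve hJ hγ ht hx).mono fun τ h ↦ h.2.2.deriv
    rw [h1.deriv_eq, h1.self_of_nhds, (hd.hasDerivAt_field_comp hy hz).deriv]
    refine (g.isLorentzForm_inChart hy).eq_zero_of_forall fun w ↦ ?_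
    rw [map_add, add_apply, g.inChart_christoffel_self hy,
      hd.metric_fderiv_field_self hy ((g.mem_extremalLocus_iff hV hx).1 (hT t ht))]
    ring

theorem exists_integralCurve (hV : g.IsKilling V) (x : M) :
    ∃ γ : ℝ → M, ∃ ε > 0, γ 0 = x ∧ IsMIntegralCurveOn γ V (Ioo (-ε) ε) := by
  have := FiniteDimensional.complete ℝ E
  have : IsManifold 𝓘(ℝ, E) 1 M := IsManifold.of_le (n := ∞) (by simp)
  obtain ⟨γ, hγ0, hγ⟩ := exists_isMIntegralCurveAt_of_contMDiffAt_boundaryless (t₀ := 0)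
    ((hV.1 x).of_le (by simp : (1 : WithTop ℕ∞) ≤ ∞))
  obtain ⟨ε, hε, h⟩ := isMIntegralCurveAt_iff'.1 hγ
  refine ⟨γ, ε, hε, hγ0, ?_⟩
  rwa [Real.ball_eq_Ioo, zero_sub, zero_add] at h

end IntegralCurves

end LorentzMetric

/-! ### Partial derivatives of maps of two real variables. -/

section PartialDerivatives

variable {F : Type*} [NormedAddCommGroup F] [NormedSpace ℝ F] {X : ℝ × ℝ → F} {s t : ℝ}

theorem HasFDerivAt.hasDerivAt_prod_left {X' : ℝ × ℝ →L[ℝ] F} (h : HasFDerivAt X X' (s, t)) :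
    HasDerivAt (fun σ ↦ X (σ, t)) (X' (1, 0)) s :=
  HasFDerivAt.comp_hasDerivAt (f := fun σ ↦ (σ, t)) s h
    ((hasDerivAt_id s).prodMk (hasDerivAt_const s t))

theorem HasFDerivAt.hasDerivAt_prod_right {X' : ℝ × ℝ →L[ℝ] F} (h : HasFDerivAt X X' (s, t)) :
    HasDerivAt (fun τ ↦ X (s, τ)) (X' (0, 1)) t :=
  HasFDerivAt.comp_hasDerivAt (f := fun τ ↦ (s, τ)) t h
    ((hasDerivAt_const t s).prodMk (hasDerivAt_id t))

theorem ContDiffAt.hasDerivAt_prod_left (h : ContDiffAt ℝ ∞ X (s, t)) :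
    HasDerivAt (fun σ ↦ X (σ, t)) (fderiv ℝ X (s, t) (1, 0)) s :=
  (h.differentiableAt (by simp)).hasFDerivAt.hasDerivAt_prod_left

theorem ContDiffAt.hasDerivAt_prod_right (h : ContDiffAt ℝ ∞ X (s, t)) :
    HasDerivAt (fun τ ↦ X (s, τ)) (fderiv ℝ X (s, t) (0, 1)) t :=
  (h.differentiableAt (by simp)).hasFDerivAt.hasDerivAt_prod_right

theorem ContDiffAt.hasFDerivAt_fderiv_apply (h : ContDiffAt ℝ ∞ X (s, t)) (e : ℝ × ℝ) :
    HasFDerivAt (fun p ↦ fderiv ℝ X p e) ((fderiv ℝ (fderiv ℝ X) (s, t)).flip e) (s, t) := by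
  have h1 := ((h.fderiv_right (m := ∞) (by simp)).differentiableAt (by simp)).hasFDerivAt
  simpa using h1.clm_apply (hasFDerivAt_const e (s, t))

/-- Mixed partial derivatives commute. -/
theorem ContDiffAt.deriv_fderiv_prod_comm (h : ContDiffAt ℝ ∞ X (s, t)) :
    deriv (fun σ ↦ fderiv ℝ X (σ, t) (0, 1)) s = deriv (fun τ ↦ fderiv ℝ X (s, τ) (1, 0)) t := by
  rw [(h.hasFDerivAt_fderiv_apply (0, 1)).hasDerivAt_prod_left.deriv,
    (h.hasFDerivAt_fderiv_apply (1, 0)).hasDerivAt_prod_right.deriv]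
  exact (h.isSymmSndFDerivAt (by simpa using two_le_infty)) _ _

end PartialDerivatives

/-! ### Geodesic families and the first integral. -/

namespace LorentzMetric

section GeodesicFamilies

variable {E : Type*} [NormedAddCommGroup E] [NormedSpace ℝ E] [FiniteDimensional ℝ E]
  {M : Type*} [TopologicalSpace M] [ChartedSpace E M] [IsManifold 𝓘(ℝ, E) ∞ M]
  {x₀ x : M} (g : LorentzMetric E M) {V : ∀ x : M, TangentSpace 𝓘(ℝ, E) x}
  {J : Set ℝ} {U : Set (ℝ × ℝ)} {Φ : ℝ × ℝ → M} {t : ℝ}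

/-- The velocity of a curve, as an element of the model space. -/
noncomputable def modelVelocity (E : Type*) [NormedAddCommGroup E] [NormedSpace ℝ E] {M : Type*}
    [TopologicalSpace M] [ChartedSpace E M] (c : ℝ → M) (t : ℝ) : E := velocity (E := E) c t

/-- The square of the velocity of a curve, minus twice its product with `V`. -/
noncomputable def energy (V : ∀ x : M, TangentSpace 𝓘(ℝ, E) x) (c : ℝ → M) (t : ℝ) : ℝ :=
  g.form (c t) (modelVelocity E c t) (modelVelocity E c t)
    - 2 * g.form (c t) (modelVelocity E c t) (modelField V (c t))

theorem energy_eq_inChart {c : ℝ → M} (hx : c t ∈ (extChartAt 𝓘(ℝ, E) x₀).source) :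
    g.energy V c t
      = g.inChart x₀ (extChartAt 𝓘(ℝ, E) x₀ (c t)) (chartDeriv x₀ (c t) (modelVelocity E c t))
          (chartDeriv x₀ (c t) (modelVelocity E c t))
        - 2 * g.inChart x₀ (extChartAt 𝓘(ℝ, E) x₀ (c t))
          (chartDeriv x₀ (c t) (modelVelocity E c t))
          (fieldInChart V x₀ (extChartAt 𝓘(ℝ, E) x₀ (c t))) := by
  rw [energy, g.form_eq_inChart hx, g.form_eq_inChart hx, fieldInChart_apply V hx]

/-- The energy of a geodesic and its Killing charge are conserved. -/
theorem hasDerivAt_energy_of_isGeodesicOn (hV : g.IsKilling V) {c : ℝ → M} (hJ : IsOpen J)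
    (hc : g.IsGeodesicOn c J) (ht : t ∈ J) : HasDerivAt (g.energy V c) 0 t := by
  have hx := mem_extChartAt_source (I := 𝓘(ℝ, E)) (c t)
  set x₀ := c t with hx₀
  have hy := (extChartAt 𝓘(ℝ, E) x₀).map_source hx
  set z : ℝ → E := fun τ ↦ extChartAt 𝓘(ℝ, E) x₀ (c τ) with hz
  have hI := (isOpen_inter_preimage_source hJ hc.1.continuousOn (E := E) x₀).mem_nhds ⟨ht, hx⟩
  have hcd : ∀ τ ∈ J, ContMDiffAt 𝓘(ℝ, ℝ) 𝓘(ℝ, E) ∞ c τ := fun τ hτ ↦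
    hc.1.contMDiffAt (hJ.mem_nhds hτ)
  have hzt : ContDiffAt ℝ ∞ z t :=
    ((contMDiffAt_extChartAt_of_mem hx).comp t (hcd t ht)).contDiffAt
  have hzd : ∀ᶠ τ in 𝓝 t, deriv z τ = chartDeriv x₀ (c τ) (modelVelocity E c τ) := by
    filter_upwards [hI] with τ hτ
    exact (hasDerivAt_extChartAt_comp ((hcd τ hτ.1).mdifferentiableAt (by simp)) hτ.2).deriv
  have hev : g.energy V c =ᶠ[𝓝 t] fun τ ↦ g.inChart x₀ (z τ) (deriv z τ) (deriv z τ)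
      - 2 * g.inChart x₀ (z τ) (deriv z τ) (fieldInChart V x₀ (z τ)) := by
    filter_upwards [hI, hzd] with τ hτ h1
    rw [g.energy_eq_inChart hτ.2, h1]
  refine HasDerivAt.congr_of_eventuallyEq ?_ hev
  refine (g.killingData hV x₀).hasDerivAt_energy hy (hzt.differentiableAt (by simp)).hasDerivAt
    (hzt.of_le two_le_infty).differentiableAt_deriv.hasDerivAt fun w ↦ ?_
  have hgeo := eq_neg_of_add_eq_zero_left (hc.2 t ht x₀ hx)
  rw [hgeo, map_neg, neg_apply, g.inChart_christoffel_self hy]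
  ring

/-- The deviation vector, as an element of the model space. -/
noncomputable def modelDeviation (E : Type*) [NormedAddCommGroup E] [NormedSpace ℝ E] {M : Type*}
    [TopologicalSpace M] [ChartedSpace E M] (Φ : ℝ × ℝ → M) (t : ℝ) : E := deviation (E := E) Φ t

/-- The Lie derivative of the deviation vector, as an element of the model space. -/
noncomputable def modelLieDeriv (V : ∀ x : M, TangentSpace 𝓘(ℝ, E) x) (Φ : ℝ × ℝ → M) (t : ℝ) :
    E := lieDerivAlong V (fun τ ↦ Φ (0, τ)) (deviation Φ) t

theorem modelLieDeriv_eq (Φ : ℝ × ℝ → M) (t : ℝ) :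
    modelLieDeriv V Φ t
      = deriv (fun τ ↦ chartDeriv (Φ (0, t)) (Φ (0, τ)) (modelDeviation E Φ τ)) t
        - fderiv ℝ (fieldInChart V (Φ (0, t))) (extChartAt 𝓘(ℝ, E) (Φ (0, t)) (Φ (0, t)))
          (modelDeviation E Φ t) := by
  conv_rhs => rw [← chartDeriv_self (E := E) (Φ (0, t)) (modelDeviation E Φ t)]
  rfl

/-- A one-parameter family of curves and its velocities, in the chart at a point of its central
curve. -/
theorem exists_chart_family (hU : IsOpen U) (hΦ : ContMDiffOn 𝓘(ℝ, ℝ × ℝ) 𝓘(ℝ, E) ∞ Φ U)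
    (h0 : ((0 : ℝ), t) ∈ U) :
    ∃ a b : ℝ → E, ContDiffAt ℝ ∞ a 0 ∧ ContDiffAt ℝ ∞ b 0 ∧
      (∀ᶠ s in 𝓝 (0 : ℝ), (s, t) ∈ U ∧
        Φ (s, t) ∈ (extChartAt 𝓘(ℝ, E) (Φ (0, t))).source ∧
        a s = extChartAt 𝓘(ℝ, E) (Φ (0, t)) (Φ (s, t)) ∧
        b s = chartDeriv (Φ (0, t)) (Φ (s, t)) (modelVelocity E (fun τ ↦ Φ (s, τ)) t)) ∧
      deriv a 0 = modelDeviation E Φ t ∧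
      deriv b 0 = deriv (fun τ ↦ chartDeriv (Φ (0, t)) (Φ (0, τ)) (modelDeviation E Φ τ)) t := by
  set x₀ := Φ (0, t) with hx₀
  have hx := mem_extChartAt_source (I := 𝓘(ℝ, E)) x₀
  set X : ℝ × ℝ → E := fun p ↦ extChartAt 𝓘(ℝ, E) x₀ (Φ p) with hX
  have hW : IsOpen (U ∩ Φ ⁻¹' (extChartAt 𝓘(ℝ, E) x₀).source) :=
    hΦ.continuousOn.isOpen_inter_preimage hU (isOpen_extChartAt_source x₀)
  have hWt : ((0 : ℝ), t) ∈ U ∩ Φ ⁻¹' (extChartAt 𝓘(ℝ, E) x₀).source := ⟨h0, hx⟩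
  have hΦd : ∀ p ∈ U, ContMDiffAt 𝓘(ℝ, ℝ × ℝ) 𝓘(ℝ, E) ∞ Φ p := fun p hp ↦
    hΦ.contMDiffAt (hU.mem_nhds hp)
  have hXd : ∀ p ∈ U ∩ Φ ⁻¹' (extChartAt 𝓘(ℝ, E) x₀).source, ContDiffAt ℝ ∞ X p := fun p hp ↦
    ((contMDiffAt_extChartAt_of_mem hp.2).comp p (hΦd p hp.1)).contDiffAt
  have hX0 := hXd _ hWt
  have hdX := hX0.fderiv_right (m := ∞) (by simp)
  have hl1 : ∀ s τ : ℝ, HasDerivAt (fun σ ↦ (σ, τ)) ((1 : ℝ), (0 : ℝ)) s := fun s τ ↦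
    (hasDerivAt_id s).prodMk (hasDerivAt_const s τ)
  have hl2 : ∀ s τ : ℝ, HasDerivAt (fun σ ↦ (s, σ)) ((0 : ℝ), (1 : ℝ)) τ := fun s τ ↦
    (hasDerivAt_const τ s).prodMk (hasDerivAt_id τ)
  have hc1 : ContDiff ℝ ∞ fun σ : ℝ ↦ (σ, t) := contDiff_id.prodMk contDiff_const
  have hev1 : ∀ᶠ s in 𝓝 (0 : ℝ), (s, t) ∈ U ∩ Φ ⁻¹' (extChartAt 𝓘(ℝ, E) x₀).source :=
    (hl1 0 t).continuousAt (hW.mem_nhds hWt)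
  have hev2 : ∀ᶠ τ in 𝓝 t, ((0 : ℝ), τ) ∈ U ∩ Φ ⁻¹' (extChartAt 𝓘(ℝ, E) x₀).source :=
    (hl2 0 t).continuousAt (hW.mem_nhds hWt)
  have hdev : ∀ τ, ((0 : ℝ), τ) ∈ U ∩ Φ ⁻¹' (extChartAt 𝓘(ℝ, E) x₀).source →
      fderiv ℝ X (0, τ) (1, 0) = chartDeriv x₀ (Φ (0, τ)) (modelDeviation E Φ τ) := fun τ hτ ↦ by
    have h1 := (hXd _ hτ).hasDerivAt_prod_left
    have hm : MDifferentiableAt 𝓘(ℝ, ℝ) 𝓘(ℝ, E) (fun s ↦ Φ (s, τ)) 0 :=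
      ((hΦd _ hτ.1).mdifferentiableAt (by simp)).comp (0 : ℝ)
        (hl1 0 τ).differentiableAt.mdifferentiableAt
    exact h1.unique (hasDerivAt_extChartAt_comp hm hτ.2)
  -- In coordinates a is the transversal curve at fixed t and b = ∂_t X is the velocity of the
  -- geodesics crossing it; its s-derivative is ∂_t Y, since mixed partials commute.
  refine ⟨fun s ↦ X (s, t), fun s ↦ fderiv ℝ X (s, t) (0, 1),
    ContDiffAt.comp (g := X) (0 : ℝ) hX0 hc1.contDiffAt,
    (ContDiffAt.comp (g := fderiv ℝ X) (0 : ℝ) hdX hc1.contDiffAt).clm_apply contDiffAt_const,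
    ?_, ?_, ?_⟩
  · filter_upwards [hev1] with s hs
    refine ⟨hs.1, hs.2, rfl, ?_⟩
    have h1 := (hXd _ hs).hasDerivAt_prod_right
    have hm : MDifferentiableAt 𝓘(ℝ, ℝ) 𝓘(ℝ, E) (fun τ ↦ Φ (s, τ)) t :=
      ((hΦd _ hs.1).mdifferentiableAt (by simp)).comp t
        (hl2 s t).differentiableAt.mdifferentiableAt
    exact h1.unique (hasDerivAt_extChartAt_comp hm hs.2)
  · rw [← chartDeriv_self x₀ (modelDeviation E Φ t)]
    exact hX0.hasDerivAt_prod_left.deriv.trans (hdev t hWt)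
  · have h3 : (fun τ ↦ chartDeriv x₀ (Φ (0, τ)) (modelDeviation E Φ τ)) =ᶠ[𝓝 t]
        fun τ ↦ fderiv ℝ X (0, τ) (1, 0) := hev2.mono fun τ hτ ↦ (hdev τ hτ).symm
    rw [h3.deriv_eq]
    exact hX0.deriv_fderiv_prod_comm

/-- The second derivative of the energy of a family of curves about an integral curve in the
extremal locus. -/
theorem deriv_deriv_energy (hV : g.IsKilling V) (hJ : IsOpen J) (hU : IsOpen U)
    (hΦ : ContMDiffOn 𝓘(ℝ, ℝ × ℝ) 𝓘(ℝ, E) ∞ Φ U)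
    (hγ : IsMIntegralCurveOn (fun t ↦ Φ (0, t)) V J) (ht : t ∈ J) (h0 : ((0 : ℝ), t) ∈ U)
    (hT : Φ (0, t) ∈ g.extremalLocus V) :
    deriv (deriv fun s ↦ g.energy V (fun τ ↦ Φ (s, τ)) t) 0
      = 2 * (g.form (Φ (0, t)) (modelLieDeriv V Φ t) (modelLieDeriv V Φ t)
        + g.hessian (g.potential V) (Φ (0, t)) (modelDeviation E Φ t)
          (modelDeviation E Φ t)) := by
  obtain ⟨a, b, ha, hb, hev, hda, hdb⟩ := exists_chart_family (E := E) hU hΦ h0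
  have hP := modelLieDeriv_eq (V := V) Φ t
  have hvel : modelVelocity E (fun τ ↦ Φ (0, τ)) t = modelField V (Φ (0, t)) :=
    velocity_integralCurve hJ hγ ht
  obtain ⟨-, hx, ha0, hb0⟩ := hev.self_of_nhds
  have hy := (extChartAt 𝓘(ℝ, E) (Φ (0, t))).map_source hx
  have hd := g.killingData hV (Φ (0, t))
  have hcrit := (g.mem_extremalLocus_iff hV hx).1 hT
  rw [← ha0] at hy hcrit hP
  set v := fieldInChart V (Φ (0, t)) with hv
  have hva : ContDiffAt ℝ ∞ (fun s ↦ v (a s)) 0 := (hd.contDiffAt_field hy).comp 0 ha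
  have hw : ContDiffAt ℝ ∞ (fun s ↦ b s - v (a s)) 0 := hb.sub hva
  have hw0 : b 0 - v (a 0) = 0 := by
    rw [hb0, hvel, ha0, hv, fieldInChart_apply V hx, sub_self]
  have hdw : deriv (fun s ↦ b s - v (a s)) 0 = modelLieDeriv V Φ t := by
    have h1 := hd.hasDerivAt_field_comp hy (ha.differentiableAt (by simp)).hasDerivAt
    rw [hP, ← hdb, ← hda]
    exact ((hb.differentiableAt (by simp)).hasDerivAt.sub h1).deriv
  -- Completing the square, with c' - V represented by b - v(a).
  have hE : (fun s ↦ g.energy V (fun τ ↦ Φ (s, τ)) t) =ᶠ[𝓝 0] fun s ↦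
      g.inChart (Φ (0, t)) (a s) (b s - v (a s)) (b s - v (a s))
        - g.inChart (Φ (0, t)) (a s) (v (a s)) (v (a s)) := by
    filter_upwards [hev] with s ⟨_, hs, has, hbs⟩
    rw [g.energy_eq_inChart (x₀ := Φ (0, t)) hs, ← has, ← hbs]
    simp only [map_sub, sub_apply]
    rw [(g.isLorentzForm_inChart (x₀ := Φ (0, t)) (y := a s)
        (has ▸ (extChartAt 𝓘(ℝ, E) (Φ (0, t))).map_source hs)).symm (v (a s)) (b s)]
    ring
  have hmain := hd.deriv_deriv_sub_sq hy (ha.of_le two_le_infty) (hw.of_le two_le_infty) hw0 hcrit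
  rw [hE.deriv.deriv_eq, hmain, hdw, hda, g.hessian_potential hV hx hT, g.form_eq_inChart hx,
    chartDeriv_self, chartDeriv_self, ha0]
  change _ - fderiv ℝ (fderiv ℝ (g.sqInChart V (Φ (0, t)))) _ _ _ = _
  ring

/-- The first integral of the deviation vector. -/
theorem exists_first_integral (hV : g.IsKilling V) (hJ : IsOpen J) (hJc : IsPreconnected J)
    (hJne : J.Nonempty) (hΦ : g.IsGeodesicFamily Φ U J)
    (hγ : IsMIntegralCurveOn (fun t ↦ Φ (0, t)) V J)
    (hT : ∀ t ∈ J, Φ (0, t) ∈ g.extremalLocus V) :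
    ∃ C : ℝ, ∀ t ∈ J, g.form (Φ (0, t)) (modelLieDeriv V Φ t) (modelLieDeriv V Φ t)
      + g.hessian (g.potential V) (Φ (0, t)) (modelDeviation E Φ t) (modelDeviation E Φ t) = C := by
  set Q : ℝ → ℝ := fun t ↦ g.form (Φ (0, t)) (modelLieDeriv V Φ t) (modelLieDeriv V Φ t)
      + g.hessian (g.potential V) (Φ (0, t)) (modelDeviation E Φ t) (modelDeviation E Φ t)
  have hQd : ∀ t ∈ J, deriv (deriv fun s ↦ g.energy V (fun τ ↦ Φ (s, τ)) t) 0 = 2 * Q t :=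
    fun t ht ↦ g.deriv_deriv_energy hV hJ hΦ.isOpen hΦ.contMDiffOn hγ ht (hΦ.mem t ht) (hT t ht)
  obtain ⟨t₁, ht₁⟩ := hJne
  refine ⟨Q t₁, fun t ht ↦ ?_⟩
  refine hJc.induction₂ (fun a b ↦ Q a = Q b) (fun t₀ ht₀ ↦ mem_nhdsWithin_of_mem_nhds ?_)
    (fun a b c _ _ _ ↦ Eq.trans) (fun a b _ _ ↦ Eq.symm) ht ht₁
  -- The range of s may shrink with t. A product neighbourhood S × T inside U gives a common range
  -- near t₀, on which the energies at τ and at t₀ agree as germs in s.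
  obtain ⟨S, hS, T, hTn, hST⟩ := mem_nhds_prod_iff.1 (hΦ.isOpen.mem_nhds (hΦ.mem t₀ ht₀))
  have hconst : ∀ᶠ τ in 𝓝 t₀, ∀ s : S, g.energy V (fun τ ↦ Φ (s, τ)) τ
      = g.energy V (fun τ ↦ Φ (s, τ)) t₀ := by
    refine eventually_eq_of_hasDerivAt_zero ?_
    filter_upwards [hTn] with τ hτ s
    exact g.hasDerivAt_energy_of_isGeodesicOn hV
      (hΦ.isOpen.preimage (by fun_prop : Continuous fun τ : ℝ ↦ ((s : ℝ), τ)))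
      (hΦ.geodesic s) (hST ⟨s.2, hτ⟩)
  filter_upwards [hconst, hJ.mem_nhds ht₀] with τ hτ hτJ
  have hev : (fun s ↦ g.energy V (fun τ ↦ Φ (s, τ)) τ) =ᶠ[𝓝 0]
      fun s ↦ g.energy V (fun τ ↦ Φ (s, τ)) t₀ := by
    filter_upwards [hS] with s hs using hτ ⟨s, hs⟩
  have h1 := hQd τ hτJ
  rw [hev.deriv.deriv_eq, hQd t₀ ht₀] at h1
  linarith

/-- If the central curve is null and the family causal, the Lie derivative of the deviation vector
is orthogonal to the field. -/
theorem form_modelLieDeriv_field (hV : g.IsKilling V) (hJ : IsOpen J) (hU : IsOpen U)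
    (hΦ : ContMDiffOn 𝓘(ℝ, ℝ × ℝ) 𝓘(ℝ, E) ∞ Φ U)
    (hγ : IsMIntegralCurveOn (fun t ↦ Φ (0, t)) V J) (ht : t ∈ J) (h0 : ((0 : ℝ), t) ∈ U)
    (hT : Φ (0, t) ∈ g.extremalLocus V) (hnull : g.normSq V (Φ (0, t)) = 0)
    (hcausal : ∀ p ∈ U, g.form (Φ p) (modelVelocity E (fun τ ↦ Φ (p.1, τ)) p.2)
      (modelVelocity E (fun τ ↦ Φ (p.1, τ)) p.2) ≤ 0) :
    g.form (Φ (0, t)) (modelField V (Φ (0, t))) (modelLieDeriv V Φ t) = 0 := by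
  obtain ⟨a, b, ha, hb, hev, hda, hdb⟩ := exists_chart_family (E := E) hU hΦ h0
  have hP := modelLieDeriv_eq (V := V) Φ t
  have hvel : modelVelocity E (fun τ ↦ Φ (0, τ)) t = modelField V (Φ (0, t)) :=
    velocity_integralCurve hJ hγ ht
  obtain ⟨-, hx, ha0, hb0⟩ := hev.self_of_nhds
  have hy := (extChartAt 𝓘(ℝ, E) (Φ (0, t))).map_source hx
  have hd := g.killingData hV (Φ (0, t))
  have hcrit := (g.mem_extremalLocus_iff hV hx).1 hT
  have hN := g.normSq_eq_sqInChart (V := V) hx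
  have hform := g.form_eq_inChart hx (modelField V (Φ (0, t))) (modelLieDeriv V Φ t)
  rw [← ha0] at hy hcrit hP hN hform
  have hbv : b 0 = fieldInChart V (Φ (0, t)) (a 0) := by
    rw [hb0, hvel, ha0, fieldInChart_apply V hx]
  have hD := hd.hasDerivAt_metric_apply hy (ha.differentiableAt (by simp)).hasDerivAt
    (hb.differentiableAt (by simp)).hasDerivAt (hb.differentiableAt (by simp)).hasDerivAt
  have hmax : IsLocalMax (fun s ↦ g.inChart (Φ (0, t)) (a s) (b s) (b s)) 0 := by
    filter_upwards [hev] with s ⟨hsU, hs, has, hbs⟩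
    have h1 := hcausal _ hsU
    rw [g.form_eq_inChart (x₀ := Φ (0, t)) hs, ← has, ← hbs] at h1
    have h2 : g.inChart (Φ (0, t)) (a 0) (b 0) (b 0) = 0 := by
      rw [hbv]
      exact hN.symm.trans hnull
    exact h1.trans h2.ge
  -- The first variation is G'(a')(v, v) + 2 G(v, b') = 0. Subtracting the criticality G'(a')(v, v)
  -- + 2 G(v, v'(a')) = 0 leaves G(v, b' - v'(a')) = 0, and b' - v'(a') is ℒ_V Y.
  have h1 := hmax.hasDerivAt_eq_zero hD
  have h2 := hd.fderiv_sq hy (deriv a 0)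
  have hc0 : fderiv ℝ (fun y ↦ g.inChart (Φ (0, t)) y (fieldInChart V (Φ (0, t)) y)
    (fieldInChart V (Φ (0, t)) y)) (a 0) = 0 := hcrit
  rw [hc0, zero_apply] at h2
  rw [hform, chartDeriv_self, chartDeriv_self, hP, ← hdb, ← hda]
  have hVv : modelField V (Φ (0, t)) = fieldInChart V (Φ (0, t)) (a 0) := by
    rw [← hbv, hb0, hvel, chartDeriv_self]
  rw [hVv, map_sub]
  rw [hbv, hd.symm _ hy (deriv b 0)] at h1
  rw [hd.symm _ hy _ (fieldInChart V (Φ (0, t)) (a 0))] at h2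
  linarith

end GeodesicFamilies

end LorentzMetric

/-! ### Bounds on the normal component. -/

/-- The constant is the minimum of H on the compact unit sphere of N, extended by homogeneity; if
the sphere is empty, N is zero and any constant works. -/
theorem exists_coercive_of_pos {E : Type*} [NormedAddCommGroup E] [NormedSpace ℝ E]
    [FiniteDimensional ℝ E] (H : E →L[ℝ] E →L[ℝ] ℝ) (N : Submodule ℝ E)
    (hN : ∀ w ∈ N, w ≠ 0 → 0 < H w w) : ∃ c > 0, ∀ w ∈ N, c * ‖w‖ ^ 2 ≤ H w w := by
  have : ProperSpace E := FiniteDimensional.proper ℝ E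
  have hK : IsCompact (Metric.sphere (0 : E) 1 ∩ N) :=
    (isCompact_sphere 0 1).inter_right N.closed_of_finiteDimensional
  rcases (Metric.sphere (0 : E) 1 ∩ N).eq_empty_or_nonempty with h | h
  · refine ⟨1, one_pos, fun w hw ↦ ?_⟩
    by_cases hw0 : w = 0
    · simp [hw0]
    · have : (‖w‖⁻¹ • w) ∈ Metric.sphere (0 : E) 1 ∩ N :=
        ⟨by simp [norm_smul, hw0], N.smul_mem _ hw⟩
      rw [h] at this
      exact this.elim
  · obtain ⟨x, hx, hmin⟩ := hK.exists_isMinOn h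
      (by fun_prop : Continuous fun w ↦ H w w).continuousOn
    have hx0 : x ≠ 0 := by
      rintro rfl
      simpa using hx.1
    refine ⟨H x x, hN x hx.2 hx0, fun w hw ↦ ?_⟩
    by_cases hw0 : w = 0
    · simp [hw0]
    · have h1 : H x x ≤ H (‖w‖⁻¹ • w) (‖w‖⁻¹ • w) :=
        hmin ⟨by simp [norm_smul, hw0], N.smul_mem _ hw⟩
      simp only [map_smul, smul_apply, smul_eq_mul] at h1
      have hn : 0 < ‖w‖ := norm_pos_iff.2 hw0
      calc H x x * ‖w‖ ^ 2 ≤ (‖w‖⁻¹ * (‖w‖⁻¹ * H w w)) * ‖w‖ ^ 2 :=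
            mul_le_mul_of_nonneg_right h1 (by positivity)
        _ = H w w := by field_simp

namespace LorentzMetric

section Bounds

variable {E : Type*} [NormedAddCommGroup E] [NormedSpace ℝ E] [FiniteDimensional ℝ E]
  {M : Type*} [TopologicalSpace M] [ChartedSpace E M] [IsManifold 𝓘(ℝ, E) ∞ M]
  {x : M} (g : LorentzMetric E M) {V : ∀ x : M, TangentSpace 𝓘(ℝ, E) x}
  {γ : ℝ → M} {J : Set ℝ} {t t₀ : ℝ} {S : Set M}

/-- The Hessian of the potential at a point of the extremal locus, as a bilinear form on the model
space. -/
noncomputable def hessForm (V : ∀ x : M, TangentSpace 𝓘(ℝ, E) x) (x : M) : E →L[ℝ] E →L[ℝ] ℝ :=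
  -(1 / 2 : ℝ) • fderiv ℝ (fderiv ℝ (g.sqInChart V x)) (extChartAt 𝓘(ℝ, E) x x)

theorem hessian_eq_hessForm (hV : g.IsKilling V) (hx : x ∈ g.extremalLocus V) (u w : E) :
    g.hessian (g.potential V) x u w = g.hessForm V x u w := by
  rw [g.hessian_potential hV (mem_extChartAt_source (I := 𝓘(ℝ, E)) x) hx, chartDeriv_self,
    chartDeriv_self]
  simp [hessForm]

theorem hessForm_symm (hV : g.IsKilling V) (hx : x ∈ g.extremalLocus V) (u w : E) :
    g.hessForm V x u w = g.hessForm V x w u := by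
  rw [← g.hessian_eq_hessForm hV hx, ← g.hessian_eq_hessForm hV hx]
  exact g.hessian_potential_symm hV hx u w

/-- The tangent space to a subset, as a subspace of the model space. -/
noncomputable def modelTangent (S : Set M) (x : M) : Submodule ℝ E := tangentTo (E := E) S x

theorem modelTangent_mono {S' : Set M} (h : S ⊆ S') (x : M) :
    modelTangent (E := E) S x ≤ modelTangent S' x :=
  Submodule.span_mono fun _ ⟨c, h0, hc, hcS, hv⟩ ↦
    ⟨c, h0, hc, hcS.mono fun _ ht ↦ h ht, hv⟩

theorem hessForm_tangent (hV : g.IsKilling V) (hx : x ∈ g.extremalLocus V) {u : E}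
    (hu : u ∈ modelTangent (g.extremalLocus V) x) (w : E) : g.hessForm V x u w = 0 := by
  rw [← g.hessian_eq_hessForm hV hx]
  exact g.hessian_potential_tangentTo hV hx hu w

/-- A property of the metric and of the Hessian of the potential that is invariant under linear
isomorphisms propagates along the integral curves in the extremal locus. -/
theorem of_invariant (hV : g.IsKilling V) (hJ : IsOpen J) (hJc : IsPreconnected J)
    (hγ : IsMIntegralCurveOn γ V J) (hT : ∀ t ∈ J, γ t ∈ g.extremalLocus V)
    {p : (E →L[ℝ] E →L[ℝ] ℝ) → (E →L[ℝ] E →L[ℝ] ℝ) → Prop}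
    (hp : ∀ (B B' H H' : E →L[ℝ] E →L[ℝ] ℝ) (A : E ≃L[ℝ] E),
      (∀ u w, B' (A u) (A w) = B u w) → (∀ u w, H' (A u) (A w) = H u w) → p B H → p B' H')
    (ht₀ : t₀ ∈ J) (ht : t ∈ J) (h₀ : p (g.form (γ t₀)) (g.hessForm V (γ t₀))) :
    p (g.form (γ t)) (g.hessForm V (γ t)) := by
  refine (hJc.induction₂ (fun a b ↦ p (g.form (γ a)) (g.hessForm V (γ a))
    ↔ p (g.form (γ b)) (g.hessForm V (γ b))) (fun a ha ↦ mem_nhdsWithin_of_mem_nhds ?_)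
    (fun a b c _ _ _ ↦ Iff.trans) (fun a b _ _ ↦ Iff.symm) ht₀ ht).1 h₀
  filter_upwards [g.eventually_exists_transport hV hJ hγ ha, hJ.mem_nhds ha] with b hb hbJ
  obtain ⟨A, hA, hA'⟩ := hb.2 (hT a ha)
  have hH : ∀ u w, g.hessForm V (γ b) (A u) (A w) = g.hessForm V (γ a) u w := fun u w ↦ by
    rw [← g.hessian_eq_hessForm hV (hT a ha), ← g.hessian_eq_hessForm hV (hT b hbJ)]
    exact hA' u w
  refine ⟨hp _ _ _ _ A hA hH, hp _ _ _ _ A.symm (fun u w ↦ ?_) (fun u w ↦ ?_)⟩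
  · simpa using (hA (A.symm u) (A.symm w)).symm
  · simpa using (hH (A.symm u) (A.symm w)).symm

/-- The normal component of a vector is bounded in terms of the Hessian, uniformly along an integral
curve in the extremal locus. -/
theorem exists_normal_bound (hV : g.IsKilling V) (hJ : IsOpen J) (hJc : IsPreconnected J)
    (hγ : IsMIntegralCurveOn γ V J) (hT : ∀ t ∈ J, γ t ∈ g.extremalLocus V)
    (hS : ∀ x ∈ g.extremalLocus V, ∃ v ∈ modelTangent (E := E) (g.extremalLocus V) x,
      g.form x v v < 0)
    (hpos : ∀ t ∈ J, ∀ w : E, (∀ z ∈ modelTangent (g.extremalLocus V) (γ t),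
      g.form (γ t) w z = 0) → w ≠ 0 → 0 < g.hessForm V (γ t) w w) (ht₀ : t₀ ∈ J) :
    ∃ c > 0, ∀ t ∈ J, ∀ w : E, (∀ z ∈ modelTangent (g.extremalLocus V) (γ t),
      g.form (γ t) w z = 0) → c * g.form (γ t) w w ≤ g.hessForm V (γ t) w w := by
  let N : Submodule ℝ E :=
    { carrier := {w | ∀ z ∈ modelTangent (g.extremalLocus V) (γ t₀), g.form (γ t₀) w z = 0}
      add_mem' := fun ha hb z hz ↦ by simp [ha z hz, hb z hz]
      zero_mem' := fun z _ ↦ by simp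
      smul_mem' := fun r a ha z hz ↦ by simp [ha z hz] }
  obtain ⟨c, hc, hcN⟩ := exists_coercive_of_pos (g.hessForm V (γ t₀)) N
    fun w hw ↦ hpos t₀ ht₀ w hw
  have hB : 0 < ‖g.form (γ t₀)‖ + 1 := by positivity
  refine ⟨c / (‖g.form (γ t₀)‖ + 1), by positivity, fun t ht w hw ↦ ?_⟩
  -- The tangent spaces of the locus are not part of the pair (B, H), so normality is rephrased as
  -- orthogonality to the kernel of H, which is transported. At t₀ only the inclusion of the tangent
  -- space in the kernel is used; at t the reverse inclusion is needed.
  refine g.of_invariant (p := fun B H ↦ ∀ w, (∀ u, (∀ z, H u z = 0) → B w u = 0) →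
    c / (‖g.form (γ t₀)‖ + 1) * B w w ≤ H w w) hV hJ hJc hγ hT ?_ ht₀ ht ?_ w ?_
  · intro B B' H H' A hA hA' h w hw
    have h1 := h (A.symm w) fun u hu ↦ by
      rw [← hA, A.apply_symm_apply]
      refine hw _ fun z ↦ ?_
      rw [← hu (A.symm z), ← hA', A.apply_symm_apply]
    rwa [← hA, ← hA', A.apply_symm_apply] at h1
  · intro w hw
    have hwN : w ∈ N := fun z hz ↦ hw z (g.hessForm_tangent hV (hT t₀ ht₀) hz)
    refine le_trans ?_ (hcN w hwN)
    have h1 : g.form (γ t₀) w w ≤ (‖g.form (γ t₀)‖ + 1) * ‖w‖ ^ 2 := by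
      have := (le_abs_self _).trans ((g.form (γ t₀)).le_opNorm₂ w w)
      nlinarith [sq_nonneg ‖w‖]
    calc c / (‖g.form (γ t₀)‖ + 1) * g.form (γ t₀) w w
        ≤ c / (‖g.form (γ t₀)‖ + 1) * ((‖g.form (γ t₀)‖ + 1) * ‖w‖ ^ 2) := by gcongr
      _ = c * ‖w‖ ^ 2 := by field_simp
  · intro u hu
    refine hw u ?_
    -- A kernel vector u is split into a tangent part and a normal part n. Then H(n, n) = 0, so
    -- positivity on normals forces n = 0.
    obtain ⟨n, hn, hun⟩ := (g.isLorentzForm_form (γ t)).exists_orthogonal_projection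
      (hS _ (hT t ht)) u
    have hHn : g.hessForm V (γ t) n n = 0 := by
      have h1 := g.hessForm_tangent hV (hT t ht) hun n
      rw [map_sub, sub_apply, hu n] at h1
      linarith
    by_cases hn0 : n = 0
    · simpa [hn0] using hun
    · exact absurd hHn (hpos t ht n hn hn0).ne'

/-- The differential of a function that vanishes on `S` vanishes on the tangent vectors to `S`. -/
theorem fderiv_comp_symm_tangent {f : M → ℝ} (hf : ContMDiff 𝓘(ℝ, E) 𝓘(ℝ, ℝ) ∞ f)
    (hfS : ∀ x ∈ S, f x = 0) {u : E} (hu : u ∈ modelTangent S x) :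
    fderiv ℝ (f ∘ (extChartAt 𝓘(ℝ, E) x).symm) (extChartAt 𝓘(ℝ, E) x x) u = 0 := by
  have hx := mem_extChartAt_source (I := 𝓘(ℝ, E)) x
  refine Submodule.span_induction (p := fun (u : E) _ ↦
    fderiv ℝ (f ∘ (extChartAt 𝓘(ℝ, E) x).symm) (extChartAt 𝓘(ℝ, E) x x) u = 0) ?_
    (map_zero _) ?_ ?_ hu
  · rintro _ ⟨c, rfl, hc, hcS, rfl⟩
    have hd1 := (hasDerivAt_extChartAt_comp (x₀ := c 0) (hc.mdifferentiableAt (by simp))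
      hx).congr_deriv (chartDeriv_self (c 0) _)
    have hd2 := ((contDiffAt_comp_symm hx (hf (c 0))).differentiableAt
      (by simp)).hasFDerivAt.comp_hasDerivAt (0 : ℝ) hd1
    refine hd2.unique ((hasDerivAt_const (0 : ℝ) (0 : ℝ)).congr_of_eventuallyEq ?_)
    filter_upwards [hcS, hc.continuousAt ((isOpen_extChartAt_source (c 0)).mem_nhds hx)]
      with t h1 h2
    simp only [Function.comp_apply]
    rw [(extChartAt 𝓘(ℝ, E) (c 0)).left_inv h2, hfS _ h1]
  · intro a b _ _ ha hb
    exact (map_add _ _ _).trans (by rw [ha, hb, add_zero])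
  · intro r a _ ha
    exact (map_smul _ _ _).trans (by rw [ha, smul_zero])

/-- The first two derivatives of `-f ^ 2` at a zero of `f`. -/
theorem fderiv_fderiv_neg_sq {f : E → ℝ} {y : E} (hf : ContDiffAt ℝ ∞ f y) (h0 : f y = 0) :
    fderiv ℝ (fun z ↦ -(f z) ^ 2) y = 0 ∧
      ∀ u w, fderiv ℝ (fderiv ℝ fun z ↦ -(f z) ^ 2) y u w
        = -2 * (fderiv ℝ f y u * fderiv ℝ f y w) := by
  have hev : fderiv ℝ (fun z ↦ -(f z) ^ 2) =ᶠ[𝓝 y] fun z ↦ (-2 * f z) • fderiv ℝ f z := by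
    filter_upwards [(hf.of_le two_le_infty).eventually (by simp)] with z hz
    have := ((hz.differentiableAt (by simp)).hasFDerivAt.pow 2).neg
    refine this.fderiv.trans ?_
    ext u
    simp
  refine ⟨hev.self_of_nhds.trans (by simp [h0]), fun u w ↦ ?_⟩
  have hd := (hf.differentiableAt (by simp)).hasFDerivAt
  have hdd := ((hf.fderiv_right (m := ∞) (by simp)).differentiableAt (by simp)).hasFDerivAt
  rw [hev.fderiv_eq, ((hd.const_mul (-2)).fun_smul hdd).fderiv]
  simp [h0]
  ring

/-- The Hessian of the potential on an evanescent ergosurface. -/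
theorem mem_extremalLocus_and_hessForm_of_normSq_eq (hV : g.IsKilling V) {f : M → ℝ}
    (hf : ContMDiff 𝓘(ℝ, E) 𝓘(ℝ, ℝ) ∞ f) (hfV : ∀ x, g.normSq V x = -(f x) ^ 2) (h0 : f x = 0) :
    x ∈ g.extremalLocus V ∧ ∀ u w, g.hessForm V x u w
      = fderiv ℝ (f ∘ (extChartAt 𝓘(ℝ, E) x).symm) (extChartAt 𝓘(ℝ, E) x x) u
        * fderiv ℝ (f ∘ (extChartAt 𝓘(ℝ, E) x).symm) (extChartAt 𝓘(ℝ, E) x x) w := by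
  have hx := mem_extChartAt_source (I := 𝓘(ℝ, E)) x
  have hsq : g.sqInChart V x =ᶠ[𝓝 (extChartAt 𝓘(ℝ, E) x x)]
      fun z ↦ -((f ∘ (extChartAt 𝓘(ℝ, E) x).symm) z) ^ 2 := by
    filter_upwards [g.normSq_comp_symm (V := V) ((extChartAt 𝓘(ℝ, E) x).map_source hx)] with z hz
    rw [← hz]
    exact hfV _
  obtain ⟨h1, h2⟩ := fderiv_fderiv_neg_sq (contDiffAt_comp_symm hx (hf x))
    (by rw [Function.comp_apply, (extChartAt 𝓘(ℝ, E) x).left_inv hx, h0])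
  refine ⟨(g.mem_extremalLocus_iff hV hx).2 (by rw [hsq.fderiv_eq, h1]), fun u w ↦ ?_⟩
  rw [hessForm, hsq.fderiv.fderiv_eq, smul_apply, smul_apply, h2, smul_eq_mul]
  ring

/-- On a timelike evanescent ergosurface the Hessian of the potential is a positive multiple of
the square of a unit normal. -/
theorem exists_unit_normal (hV : g.IsKilling V) {f : M → ℝ}
    (hf : ContMDiff 𝓘(ℝ, E) 𝓘(ℝ, ℝ) ∞ f) (hfV : ∀ x, g.normSq V x = -(f x) ^ 2) (h0 : f x = 0)
    (htl : ∃ v ∈ modelTangent (E := E) {x | f x = 0} x, g.form x v v < 0)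
    (hne : ∃ u w, g.hessForm V x u w ≠ 0) :
    ∃ α > 0, ∃ n, g.form x n n = 1 ∧
      ∀ u w, g.hessForm V x u w = α * g.form x n u * g.form x n w := by
  obtain ⟨-, hH⟩ := g.mem_extremalLocus_and_hessForm_of_normSq_eq hV hf hfV h0
  set D := fderiv ℝ (f ∘ (extChartAt 𝓘(ℝ, E) x).symm) (extChartAt 𝓘(ℝ, E) x x)
  have hB := g.isLorentzForm_form x
  -- m is the gradient of f. It is orthogonal to the timelike tangent vector T, and nonzero because
  -- H = df ⊗ df is; hence it is spacelike. Then α = g(m, m) and n = m/√α.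
  set m := ContinuousLinearMap.inverse (g.form x) D
  have hmD : g.form x m = D := hB.apply_inverse D
  obtain ⟨T, hT, hTT⟩ := htl
  have hDT : D T = 0 := fderiv_comp_symm_tangent hf (fun x hx ↦ hx) hT
  have hm0 : m ≠ 0 := by
    intro h
    obtain ⟨u, w, huw⟩ := hne
    rw [h, map_zero] at hmD
    rw [hH, ← hmD] at huw
    simp at huw
  have hmm : 0 < g.form x m m :=
    hB.pos_of_orthogonal hTT (by rw [hB.symm, hmD, hDT]) hm0
  have hss := Real.mul_self_sqrt hmm.le
  refine ⟨g.form x m m, hmm, (√(g.form x m m))⁻¹ • m, ?_, fun u w ↦ ?_⟩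
  · simp only [map_smul, smul_apply, smul_eq_mul]
    rw [← mul_assoc, ← mul_inv, hss, inv_mul_cancel₀ hmm.ne']
  · simp only [map_smul, smul_apply, smul_eq_mul]
    rw [hH, ← hmD]
    calc g.form x m u * g.form x m w
        = (g.form x m m * (√(g.form x m m) * √(g.form x m m))⁻¹)
            * (g.form x m u * g.form x m w) := by rw [hss, mul_inv_cancel₀ hmm.ne', one_mul]
      _ = _ := by rw [mul_inv]; ring

end Bounds

end LorentzMetric

/-! ### Assembly of the theorem. -/

theorem mainTheorem2 {E : Type*} [NormedAddCommGroup E] [NormedSpace ℝ E] [FiniteDimensional ℝ E]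
    {M : Type*} [TopologicalSpace M] [T2Space M] [ChartedSpace E M] [IsManifold 𝓘(ℝ, E) ∞ M]
    (g : LorentzMetric E M) (V : ∀ x : M, TangentSpace 𝓘(ℝ, E) x) (hV : g.IsKilling V) :
    -- an integral curve of `V` passes through each point of the extremal locus
    (∀ x ∈ g.extremalLocus V, ∃ γ : ℝ → M, ∃ ε > 0, γ 0 = x ∧
      IsMIntegralCurveOn γ V (Ioo (-ε) ε)) ∧
    -- the integral curves that meet the locus stay in it and are affinely parametrized geodesics
    (∀ (γ : ℝ → M) (J : Set ℝ), IsOpen J → IsPreconnected J → IsMIntegralCurveOn γ V J →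
      (∃ t₀ ∈ J, γ t₀ ∈ g.extremalLocus V) →
      (∀ t ∈ J, γ t ∈ g.extremalLocus V) ∧ g.IsGeodesicOn γ J) ∧
    -- deviation vectors `Y` along such a geodesic `γ = Φ (0, ·)`
    (∀ (J : Set ℝ) (U : Set (ℝ × ℝ)) (Φ : ℝ × ℝ → M),
      IsOpen J → IsPreconnected J → J.Nonempty → g.IsGeodesicFamily Φ U J →
      IsMIntegralCurveOn (fun t ↦ Φ (0, t)) V J →
      (∀ t ∈ J, Φ (0, t) ∈ g.extremalLocus V) →
      ∃ C : ℝ,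
        -- the first integral
        (∀ t ∈ J,
          g.val (Φ (0, t)) (LorentzMetric.lieDerivAlong V (fun τ ↦ Φ (0, τ))
              (LorentzMetric.deviation Φ) t)
            (LorentzMetric.lieDerivAlong V (fun τ ↦ Φ (0, τ)) (LorentzMetric.deviation Φ) t)
          + g.hessian (g.potential V) (Φ (0, t)) (LorentzMetric.deviation Φ t)
              (LorentzMetric.deviation Φ t) = C) ∧
        -- `γ` null and the family causal
        ((∀ t ∈ J, g.IsNull (V (Φ (0, t)))) →
          (∀ p ∈ U, g.IsCausal (LorentzMetric.velocity (E := E) (fun t ↦ Φ (p.1, t)) p.2)) →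
          (∀ t ∈ J, 0 ≤
            g.val (Φ (0, t)) (LorentzMetric.lieDerivAlong V (fun τ ↦ Φ (0, τ))
                (LorentzMetric.deviation Φ) t)
              (LorentzMetric.lieDerivAlong V (fun τ ↦ Φ (0, τ))
                (LorentzMetric.deviation Φ) t)) ∧
          -- `-V²/2` minimized on `γ`
          ((∀ t ∈ J, IsLocalMin (g.potential V) (Φ (0, t))) →
            0 ≤ C ∧
            (∀ t ∈ J, ∀ u : TangentSpace 𝓘(ℝ, E) (Φ (0, t)),
              0 ≤ g.hessian (g.potential V) (Φ (0, t)) u u) ∧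
            (∀ t ∈ J, g.hessian (g.potential V) (Φ (0, t)) (LorentzMetric.deviation Φ t)
              (LorentzMetric.deviation Φ t) ≤ C) ∧
            -- the locus is a timelike submanifold, the Hessian positive definite on its normals
            (g.IsTimelikeSubmanifold (g.extremalLocus V) →
              (∀ t ∈ J, ∀ w : TangentSpace 𝓘(ℝ, E) (Φ (0, t)),
                g.IsNormalTo (g.extremalLocus V) (Φ (0, t)) w → w ≠ 0 →
                0 < g.hessian (g.potential V) (Φ (0, t)) w w) →
              ∃ K : ℝ, ∀ t ∈ J, ∃ w : TangentSpace 𝓘(ℝ, E) (Φ (0, t)),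
                g.IsNormalTo (g.extremalLocus V) (Φ (0, t)) w ∧
                LorentzMetric.deviation Φ t - w ∈
                  LorentzMetric.tangentTo (g.extremalLocus V) (Φ (0, t)) ∧
                g.hessian (g.potential V) (Φ (0, t)) w w ≤ C ∧
                0 ≤ g.val (Φ (0, t)) w w ∧ g.val (Φ (0, t)) w w ≤ K)) ∧
          -- the evanescent ergosurface `f = 0`, where `V² = -f²` has a second order zero
          (∀ f : M → ℝ, ContMDiff 𝓘(ℝ, E) 𝓘(ℝ, ℝ) ∞ f → (∀ x, g.normSq V x = -(f x) ^ 2) →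
            g.IsTimelikeHypersurface {x | f x = 0} →
            (∀ x, f x = 0 → ∃ u v : TangentSpace 𝓘(ℝ, E) x,
              g.hessian (g.potential V) x u v ≠ 0) →
            ∃ α > 0, ∀ t ∈ J, ∃ n : TangentSpace 𝓘(ℝ, E) (Φ (0, t)),
              g.IsNormalTo {x | f x = 0} (Φ (0, t)) n ∧ g.val (Φ (0, t)) n n = 1 ∧
              (∀ u v : TangentSpace 𝓘(ℝ, E) (Φ (0, t)),
                g.hessian (g.potential V) (Φ (0, t)) u v =
                  α * g.val (Φ (0, t)) n u * g.val (Φ (0, t)) n v) ∧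
              g.val (Φ (0, t)) n (LorentzMetric.deviation Φ t) ^ 2 ≤ C / α))) := by
  refine ⟨fun x _ ↦ g.exists_integralCurve hV x, ?_, ?_⟩
  · rintro γ J hJ hJc hγ ⟨t₀, ht₀, h₀⟩
    have hT := fun t ht ↦ g.mem_extremalLocus_of_integralCurve (t := t) hV hJ hJc hγ ht₀ h₀ ht
    exact ⟨hT, g.isGeodesicOn_of_integralCurve hV hJ hγ hT⟩
  intro J U Φ hJ hJc hJne hΦ hγ hT
  obtain ⟨C, hC⟩ := g.exists_first_integral hV hJ hJc hJne hΦ hγ hT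
  refine ⟨C, hC, fun hnull hcausal ↦ ?_⟩
  have hLL : ∀ t ∈ J, 0 ≤ g.form (Φ (0, t)) (LorentzMetric.modelLieDeriv V Φ t)
      (LorentzMetric.modelLieDeriv V Φ t) := fun t ht ↦
    (g.isLorentzForm_form _).nonneg_of_orthogonal (hnull t ht).2.le (hnull t ht).1
      (g.form_modelLieDeriv_field hV hJ hΦ.isOpen hΦ.contMDiffOn hγ ht (hΦ.mem t ht) (hT t ht)
        (hnull t ht).2 fun p hp ↦ (hcausal p hp).2)
  have hYY : ∀ t ∈ J, g.hessForm V (Φ (0, t)) (LorentzMetric.modelDeviation E Φ t)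
      (LorentzMetric.modelDeviation E Φ t) ≤ C := fun t ht ↦ by
    rw [← g.hessian_eq_hessForm hV (hT t ht)]
    linarith [hC t ht, hLL t ht]
  refine ⟨hLL, fun hmin ↦ ?_, fun f hf hfV hS hne ↦ ?_⟩
  · have hpsd := fun t ht ↦ g.hessian_potential_nonneg hV (hT t ht) (hmin t ht)
    refine ⟨?_, hpsd, fun t ht ↦ ?_, fun hTL hpos ↦ ?_⟩
    · obtain ⟨t, ht⟩ := hJne
      linarith [hC t ht, hLL t ht, hpsd t ht (LorentzMetric.modelDeviation E Φ t)]
    · exact (g.hessian_eq_hessForm hV (hT t ht) _ _).trans_le (hYY t ht)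
    · obtain ⟨t₀, ht₀⟩ := hJne
      obtain ⟨c, hc, hbound⟩ := g.exists_normal_bound hV hJ hJc hγ hT hTL.2
        (fun t ht w hw hw0 ↦ (hpos t ht w hw hw0).trans_eq
          (g.hessian_eq_hessForm hV (hT t ht) w w)) ht₀
      refine ⟨C / c, fun t ht ↦ ?_⟩
      have hB := g.isLorentzForm_form (Φ (0, t))
      obtain ⟨w, hw, hYw⟩ := hB.exists_orthogonal_projection (hTL.2 _ (hT t ht))
        (LorentzMetric.modelDeviation E Φ t)
      -- The tangential part Y - w is in the kernel of H, so H(w, w) = H(Y, Y).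
      have hww : g.hessForm V (Φ (0, t)) w w ≤ C := by
        refine le_trans (le_of_eq ?_) (hYY t ht)
        have h1 := fun z ↦ g.hessForm_tangent hV (hT t ht) hYw z
        have h2 := h1 (LorentzMetric.modelDeviation E Φ t)
        have h3 := h1 w
        rw [map_sub, sub_apply] at h2 h3
        rw [g.hessForm_symm hV (hT t ht)] at h3
        linarith [g.hessForm_symm hV (hT t ht) (LorentzMetric.modelDeviation E Φ t) w]
      refine ⟨w, hw, hYw, (g.hessian_eq_hessForm hV (hT t ht) w w).trans_le hww, ?_, ?_⟩
      · obtain ⟨v, hv, hvv⟩ : ∃ v ∈ LorentzMetric.modelTangent (E := E) (g.extremalLocus V)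
            (Φ (0, t)), g.form (Φ (0, t)) v v < 0 := hTL.2 _ (hT t ht)
        refine hB.nonneg_of_orthogonal (v := v) hvv.le ?_ ((hB.symm v w).trans (hw v hv))
        rintro rfl
        simp at hvv
      · rw [le_div_iff₀ hc, mul_comm]
        exact (hbound t ht w hw).trans hww
  · have hf0 : ∀ t ∈ J, f (Φ (0, t)) = 0 := fun t ht ↦ by
      have h1 := (hfV (Φ (0, t))).symm.trans (hnull t ht).2
      simpa using h1
    obtain ⟨t₀, ht₀⟩ := hJne
    obtain ⟨α, hα, hn₀⟩ := g.exists_unit_normal hV hf hfV (hf0 t₀ ht₀)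
      (hS.1.2 _ (hf0 t₀ ht₀)) (by
        obtain ⟨u, w, huw⟩ := hne _ (hf0 t₀ ht₀)
        exact ⟨u, w, fun h ↦ huw ((g.hessian_eq_hessForm hV (hT t₀ ht₀) u w).trans h)⟩)
    refine ⟨α, hα, fun t ht ↦ ?_⟩
    -- With α fixed at t₀, the existence of a unit n with H = α n ⊗ n depends only on the pair (g,
    -- H) up to isomorphism, so the same α serves along all of γ.
    obtain ⟨n, hn, hH⟩ := g.of_invariant (p := fun B H ↦ ∃ n, B n n = 1 ∧
      ∀ u w, H u w = α * B n u * B n w) hV hJ hJc hγ hT (by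
        rintro B B' H H' A hA hA' ⟨n, hn, hH⟩
        refine ⟨A n, (hA n n).trans hn, fun u w ↦ ?_⟩
        rw [← A.apply_symm_apply u, ← A.apply_symm_apply w, hA', hA, hA, hH]) ht₀ ht hn₀
    refine ⟨n, fun v hv ↦ ?_, hn,
      fun u w ↦ (g.hessian_eq_hessForm hV (hT t ht) u w).trans (hH u w), ?_⟩
    -- The unit vector transported from t₀ is normal to the surface at t: for v tangent to it, α
    -- g(n, v) = H(v, n) = 0, because the surface lies in the locus.
    · have hsub : {x | f x = 0} ⊆ g.extremalLocus V := fun x hx ↦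
        (g.mem_extremalLocus_and_hessForm_of_normSq_eq hV hf hfV hx).1
      have h1 := (hH v n).symm.trans (g.hessForm_tangent hV (hT t ht)
        (LorentzMetric.modelTangent_mono (E := E) hsub _ hv) n)
      rw [hn, mul_one] at h1
      exact (mul_eq_zero.1 h1).resolve_left hα.ne'
    · have h1 := hYY t ht
      rw [hH] at h1
      rw [le_div_iff₀ hα]
      refine le_trans (le_of_eq ?_) h1
      change g.form (Φ (0, t)) n (LorentzMetric.modelDeviation E Φ t) ^ 2 * α = _
      ring
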